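/- Let $D$ be a finite set of $d$ values and $V_1,\dots,V_n$ variables ranging over $D$. Events are given by the grammar $\varepsilon ::= (V_i=v)\mid \neg\varepsilon\mid \varepsilon\wedge\varepsilon$ with $v\in D$. An instance of the problem $\mathrm{SAT}(\mathsf{prob},\mathsf{base})$ consists of $D$, the variables $V_1,\dots,V_n$, and a finite set $\phi$ of inequalities $\Pr(\varepsilon)\le\Pr(\varepsilon')$ between probabilities of such events. The question is whether there is a recursive structural causal model satisfying all inequalities of $\phi$. Such a model consists of a well-order $\prec$ on $\{V_1,\dots,V_n\}$, finitely many hidden variables with finite ranges, a joint probability distribution of the hidden variables, and, for each $V_i$, a function that determines the value of $V_i$ in $D$ from the values of the hidden variables and of the variables $V_j\prec V_i$; $\Pr(\varepsilon)$ is the probability that the resulting values of $V_1,\dots,V_n$ satisfy $\varepsilon$. The primal graph of $\phi$ has vertices $V_1,\dots,V_n$, with two distinct variables adjacent if and only if some term $\Pr(\varepsilon)$ of $\phi$ contains both. The primal treewidth of $\phi$ is the treewidth of this graph (taken to be $0$ if $n=0$). A parameterized reduction from a parameterized problem $A$ to a parameterized problem $B$ maps every instance $x$ of $A$ with parameter $k$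 to an instance $y$ of $B$ with parameter at most $g(k)$ such that $x$ is a yes-instance if and only if $y$ is, and is computed by a deterministic Turing machine in time $f(k)\cdot|x|^{O(1)}$, where $f,g$ are computable functions. $\mathrm{W}[1]$ is the class of parameterized problems that have, for some constant $h$, a parameterized reduction to the following problem: given a Boolean circuit of weft at most $1$ and depth at most $h$, and a number $k$ (the parameter), does the circuit have a satisfying assignment setting exactly $k$ input nodes to true? A problem is $\mathrm{W}[1]$-hard if every problem in $\mathrm{W}[1]$ has a parameterized reduction to it. **Theorem.** $\mathrm{SAT}(\mathsf{prob},\mathsf{base})$ is $\mathrm{W}[1]$-hard parameterized by the number $n$ of variables, and it is also $\mathrm{W}[1]$-hard parameterized by the primal treewidth of $\phi$. -/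

import Mathlib

namespace CausalSat

/-! ### Parameterized problems, parameterized reductions -/

/-- A parameterized decision problem: instances written as strings over a finite alphabet,
the set of yes-instances, and the parameter of each instance. -/
structure ParamProblem where
  Inst : Type
  Sym : Type
  finSym : Finite Sym
  enc : Inst → List Sym
  enc_injective : Function.Injective enc
  yes : Inst → Prop
  param : Inst → ℕ

/-- The map `r` is computed by a deterministic multi-stack Turing machine that, on an instance `a`
of `P`, makes at most `f (param a) * p (|a|)` steps, where `f` is a computable function and `p` is a
polynomial. -/
def FPTComputable (P Q : ParamProblem) (r : P.Inst → Q.Inst) : Prop :=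
  ∃ (M : Turing.TM2ComputableAux P.Sym Q.Sym) (f : ℕ → ℕ) (p : Polynomial ℕ), Computable f ∧
    ∀ a : P.Inst, Nonempty (Turing.TM2OutputsInTime M.tm
      ((P.enc a).map M.inputAlphabet.symm)
      (some ((Q.enc (r a)).map M.outputAlphabet.symm))
      (f (P.param a) * p.eval (P.enc a).length))

/-- Parameterized (many-one) reducibility. -/
def FPTReduces (P Q : ParamProblem) : Prop :=
  ∃ r : P.Inst → Q.Inst, FPTComputable P Q r ∧
    (∀ a, P.yes a ↔ Q.yes (r a)) ∧
    ∃ g : ℕ → ℕ, Computable g ∧ ∀ a, Q.param (r a) ≤ g (P.param a)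

/-! ### Strings -/

/-- The alphabet in which circuits and formulas are written. -/
inductive Token where
  | bit | sep | next | last | atom | neg | and | or
  deriving DecidableEq

instance : Fintype Token where
  elems := {Token.bit, Token.sep, Token.next, Token.last, Token.atom, Token.neg, Token.and, Token.or}
  complete := by intro x; cases x <;> decide

/-- Unary code of a natural number. -/
def encNat (n : ℕ) : List Token := List.replicate n Token.bit ++ [Token.sep]

/-- Code of a list, given a code of its members. -/
def encList {α : Type} (e : α → List Token) : List α → List Token
  | [] => [Token.last]
  | a :: l => Token.next :: (e a ++ encList e l)

/-- Unique readability of a code at the beginning of a string. -/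
def IsPrefixCode {α : Type} (e : α → List Token) : Prop :=
  ∀ a b s t, e a ++ s = e b ++ t → a = b ∧ s = t

theorem IsPrefixCode.injective {α : Type} {e : α → List Token} (h : IsPrefixCode e) :
    Function.Injective e := fun a b hab => (h a b [] [] (by simpa using hab)).1

theorem isPrefixCode_encNat : IsPrefixCode encNat := by
  intro a
  induction a with
  | zero =>
    intro b s t h
    cases b with
    | zero => simpa [encNat] using h
    | succ b => simp [encNat, List.replicate_succ] at h
  | succ a ih =>
    intro b s t h
    cases b with
    | zero => simp [encNat, List.replicate_succ] at h
    | succ b =>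
      have h' : encNat a ++ s = encNat b ++ t := by
        simpa [encNat, List.replicate_succ] using h
      obtain ⟨h1, h2⟩ := ih b s t h'
      exact ⟨by rw [h1], h2⟩

theorem isPrefixCode_encList {α : Type} {e : α → List Token} (he : IsPrefixCode e) :
    IsPrefixCode (encList e) := by
  intro l
  induction l with
  | nil =>
    intro l' s t h
    cases l' with
    | nil => simpa [encList] using h
    | cons b l' => simp [encList] at h
  | cons a l ih =>
    intro l' s t h
    cases l' with
    | nil => simp [encList] at h
    | cons b l' =>
      simp only [encList, List.cons_append, List.append_assoc, List.cons.injEq, true_and] at h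
      obtain ⟨h1, h2⟩ := he _ _ _ _ h
      obtain ⟨h3, h4⟩ := ih _ _ _ h2
      exact ⟨by rw [h1, h3], h4⟩

/-! ### Boolean circuits, weighted circuit satisfiability, the class W[1] -/

/-- A gate of a circuit, with the list of its in-neighbours. -/
inductive Gate where
  | neg (j : ℕ)
  | and (l : List ℕ)
  | or (l : List ℕ)

/-- In-neighbours of a gate. -/
def Gate.preds : Gate → List ℕ
  | .neg j => [j]
  | .and l => l
  | .or l => l

/-- Value of a gate, given the values of all earlier nodes. -/
def Gate.value (vals : List Bool) : Gate → Bool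
  | .neg j => !(vals.getD j false)
  | .and l => l.all fun j => vals.getD j false
  | .or l => l.any fun j => vals.getD j false

/-- A Boolean circuit whose nodes are numbered topologically: the nodes `0, …, inputs - 1` are the
input nodes and node `inputs + i` is the `i`-th gate; `out` is the output node. -/
structure Circuit where
  inputs : ℕ
  gates : List Gate
  out : ℕ

namespace Circuit

/-- The circuit is a directed acyclic graph: the in-neighbours of a gate are distinct earlier nodes,
and there is at least one of them. -/
def WellFormed (C : Circuit) : Prop :=
  C.out < C.inputs + C.gates.length ∧
  ∀ (i : ℕ) (g : Gate), C.gates[i]? = some g →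
    g.preds ≠ [] ∧ g.preds.Nodup ∧ ∀ j ∈ g.preds, j < C.inputs + i

/-- Data attached to the nodes in topological order: `init` on the input nodes, and `step` computes
the datum of a gate from the data of all earlier nodes. -/
def nodeData {α : Type} (C : Circuit) (init : List α) (step : List α → Gate → α) : List α :=
  C.gates.foldl (fun vals g => vals ++ [step vals g]) init

/-- Output value under an assignment to the input nodes. -/
def eval (C : Circuit) (x : Fin C.inputs → Bool) : Bool :=
  (C.nodeData (List.ofFn x) fun vals g => g.value vals).getD C.out false

/-- The maximum, over the in-neighbours of `g`, of the given data. -/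
def maxPred (data : List ℕ) (g : Gate) : ℕ :=
  (g.preds.map fun j => data.getD j 0).foldr max 0

/-- Maximum length of a path from an input node to the output node. -/
def depth (C : Circuit) : ℕ :=
  (C.nodeData (List.replicate C.inputs 0) fun data g => maxPred data g + 1).getD C.out 0

/-- Maximum number of large nodes (nodes of in-degree more than two) on a path from an input node
to the output node. -/
def weft (C : Circuit) : ℕ :=
  (C.nodeData (List.replicate C.inputs 0) fun data g =>
    maxPred data g + if 2 < g.preds.length then 1 else 0).getD C.out 0

/-- `C` has a satisfying assignment that sets exactly `k` input nodes to true. -/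
def HasWeightedSolution (C : Circuit) (k : ℕ) : Prop :=
  ∃ x : Fin C.inputs → Bool, (Finset.univ.filter fun i => x i = true).card = k ∧ C.eval x = true

end Circuit

def encGate : Gate → List Token
  | .neg j => Token.neg :: encNat j
  | .and l => Token.and :: encList encNat l
  | .or l => Token.or :: encList encNat l

def encCircuit (C : Circuit) : List Token :=
  encNat C.inputs ++ (encNat C.out ++ encList encGate C.gates)

theorem isPrefixCode_encGate : IsPrefixCode encGate := by
  intro a b s t h
  have hl := isPrefixCode_encList isPrefixCode_encNat
  cases a <;> cases b <;> simp [encGate] at h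
  · simpa using isPrefixCode_encNat _ _ _ _ h
  · simpa using hl _ _ _ _ h
  · simpa using hl _ _ _ _ h

theorem isPrefixCode_encCircuit : IsPrefixCode encCircuit := by
  rintro ⟨n, g, o⟩ ⟨n', g', o'⟩ s t h
  simp only [encCircuit, List.append_assoc] at h
  obtain ⟨h1, h'⟩ := isPrefixCode_encNat _ _ _ _ h
  obtain ⟨h2, h''⟩ := isPrefixCode_encNat _ _ _ _ h'
  obtain ⟨h3, h4⟩ := isPrefixCode_encList isPrefixCode_encGate _ _ _ _ h''
  exact ⟨by rw [h1, h2, h3], h4⟩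

/-- Circuits of weft at most `t` and depth at most `d`. -/
def BoundedCircuit (t d : ℕ) : Type :=
  {C : Circuit // C.WellFormed ∧ C.weft ≤ t ∧ C.depth ≤ d}

/-- Weighted circuit satisfiability for circuits of weft at most `t` and depth at most `d`,
parameterized by the weight. -/
def weightedCircuitSat (t d : ℕ) : ParamProblem where
  Inst := BoundedCircuit t d × ℕ
  Sym := Token
  finSym := inferInstance
  enc I := encNat I.2 ++ encCircuit I.1.1
  enc_injective := by
    rintro ⟨⟨C, hC⟩, k⟩ ⟨⟨C', hC'⟩, k'⟩ h
    obtain ⟨rfl, h⟩ := isPrefixCode_encNat _ _ _ _ h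
    obtain rfl := isPrefixCode_encCircuit.injective h
    rfl
  yes I := I.1.1.HasWeightedSolution I.2
  param I := I.2

/-- The class W[1]: problems with a parameterized reduction to weighted satisfiability of circuits of
weft at most one and depth at most `d`, for some constant `d`. -/
def InW1 (P : ParamProblem) : Prop :=
  ∃ d : ℕ, FPTReduces P (weightedCircuitSat 1 d)

/-- W[1]-hardness. -/
def IsW1Hard (Q : ParamProblem) : Prop :=
  ∀ P : ParamProblem, InW1 P → FPTReduces P Q

/-! ### Syntax: base inequalities between probabilities of propositional events -/

/-- Propositional events over the variables `Fin n` with values in the domain `Fin d`. -/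
inductive Event (n d : ℕ) where
  | atom (V : Fin n) (v : Fin d)
  | neg (ε : Event n d)
  | and (ε₁ ε₂ : Event n d)

/-- The variables that occur in an event. -/
def Event.vars {n d : ℕ} : Event n d → Finset (Fin n)
  | .atom V _ => {V}
  | .neg ε => ε.vars
  | .and ε₁ ε₂ => ε₁.vars ∪ ε₂.vars

/-- The event holds under the assignment `s`. -/
def Event.Holds {n d : ℕ} (s : Fin n → Fin d) : Event n d → Prop
  | .atom V v => s V = v
  | .neg ε => ¬ ε.Holds s
  | .and ε₁ ε₂ => ε₁.Holds s ∧ ε₂.Holds s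

/-- The inequality `Pr(lhs) ≤ Pr(rhs)`. -/
structure BaseIneq (n d : ℕ) where
  lhs : Event n d
  rhs : Event n d

/-- An instance of SAT(prob, base): a domain of `d` values, `n` variables and a finite collection
of inequalities. -/
structure SatInstance where
  n : ℕ
  d : ℕ
  φ : List (BaseIneq n d)

/-! ### Semantics: recursive structural causal models -/

/-- Recursive structural causal models with observed variables `Fin n` over the domain `Fin d`. -/
structure SCM (n d : ℕ) where
  /-- The well-order of the observed variables. -/
  prec : Fin n → Fin n → Prop
  wo : IsWellOrder (Fin n) prec
  /-- The hidden variables and their ranges. -/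
  Hidden : Type
  finHidden : Finite Hidden
  Val : Hidden → Type
  finVal : ∀ U, Finite (Val U)
  /-- The value of an observed variable in terms of the hidden and the preceding observed ones. -/
  F : (V : Fin n) → ((U : Hidden) → Val U) → ({W : Fin n // prec W V} → Fin d) → Fin d
  /-- The joint distribution of the hidden variables. -/
  P : PMF ((U : Hidden) → Val U)

/-- The values of the observed variables that result from the values `u` of the hidden ones. -/
noncomputable def SCM.eval {n d : ℕ} (M : SCM n d) (u : (U : M.Hidden) → M.Val U) :
    Fin n → Fin d :=
  M.wo.wf.fix fun V ih => M.F V u fun W => ih W.1 W.2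

theorem SCM.eval_eq {n d : ℕ} (M : SCM n d) (u : (U : M.Hidden) → M.Val U) (V : Fin n) :
    M.eval u V = M.F V u fun W => M.eval u W.1 := by
  unfold SCM.eval
  rw [WellFounded.fix_eq]

/-- The interpretation of the term `Pr(ε)`. -/
noncomputable def SCM.prob {n d : ℕ} (M : SCM n d) (ε : Event n d) : ENNReal :=
  ∑' u : {u : (U : M.Hidden) → M.Val U // ε.Holds (M.eval u)}, M.P u.1

def SatInstance.Satisfiable (I : SatInstance) : Prop :=
  ∃ M : SCM I.n I.d, ∀ c ∈ I.φ, M.prob c.lhs ≤ M.prob c.rhs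

/-! ### Primal treewidth -/

/-- The primal graph: two variables are adjacent if some term contains both. -/
def SatInstance.primalGraph (I : SatInstance) : SimpleGraph (Fin I.n) where
  Adj V W := V ≠ W ∧ ∃ c ∈ I.φ,
    (V ∈ c.lhs.vars ∧ W ∈ c.lhs.vars) ∨ (V ∈ c.rhs.vars ∧ W ∈ c.rhs.vars)
  symm := ⟨fun _ _ h => ⟨h.1.symm, by
    obtain ⟨c, hc, h | h⟩ := h.2
    · exact ⟨c, hc, Or.inl h.symm⟩
    · exact ⟨c, hc, Or.inr h.symm⟩⟩⟩
  loopless := ⟨fun _ h => h.1 rfl⟩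

/-- A finite rooted tree, given by its parent function. -/
structure RootedTree where
  Node : Type
  finNode : Fintype Node
  root : Node
  parent : Node → Option Node
  parent_root : parent root = none
  reaches_root : ∀ N, Relation.ReflTransGen (fun A B => parent A = some B) N root

def RootedTree.children (T : RootedTree) (N : T.Node) : Set T.Node :=
  {M | T.parent M = some N}

/-- A set of nodes forms a subtree if it has a topmost node and contains the parent of each of its
other nodes. -/
def RootedTree.IsSubtree (T : RootedTree) (S : Set T.Node) : Prop :=
  ∃ top ∈ S, ∀ N ∈ S, N ≠ top → ∃ M ∈ S, T.parent N = some M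

/-- Nice tree decompositions. -/
structure NiceTreeDecomposition {α : Type} [DecidableEq α] (G : SimpleGraph α) where
  T : RootedTree
  bag : T.Node → Finset α
  edge_covered : ∀ v w, G.Adj v w → ∃ N, v ∈ bag N ∧ w ∈ bag N
  subtree : ∀ v, T.IsSubtree {N | v ∈ bag N}
  bag_root : bag T.root = ∅
  bag_leaf : ∀ N, T.children N = ∅ → bag N = ∅
  /-- A node that is not a leaf is an introduce, a forget or a join node. -/
  kind : ∀ N, T.children N ≠ ∅ →
    (∃ M v, T.children N = {M} ∧ v ∉ bag M ∧ bag N = insert v (bag M)) ∨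
    (∃ M v, T.children N = {M} ∧ v ∈ bag M ∧ bag N = (bag M).erase v) ∨
    (∃ M₁ M₂, M₁ ≠ M₂ ∧ T.children N = {M₁, M₂} ∧ bag N = bag M₁ ∧ bag N = bag M₂)

/-- The size of the largest bag minus one (and `0` for the graph without vertices). -/
def NiceTreeDecomposition.width {α : Type} [DecidableEq α] {G : SimpleGraph α}
    (X : NiceTreeDecomposition G) : ℕ :=
  letI := X.T.finNode
  (Finset.univ.sup fun N => (X.bag N).card) - 1

/-- Minimum width of a nice tree decomposition. -/
noncomputable def treewidth {α : Type} [DecidableEq α] (G : SimpleGraph α) : ℕ :=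
  sInf {w | ∃ X : NiceTreeDecomposition G, X.width = w}

/-! ### The two parameterizations of SAT(prob, base) -/

def encEvent {n d : ℕ} : Event n d → List Token
  | .atom V v => Token.atom :: (encNat V ++ encNat v)
  | .neg ε => Token.neg :: encEvent ε
  | .and ε₁ ε₂ => Token.and :: (encEvent ε₁ ++ encEvent ε₂)

def encIneq {n d : ℕ} (c : BaseIneq n d) : List Token :=
  encEvent c.lhs ++ encEvent c.rhs

def encSatInstance (I : SatInstance) : List Token :=
  encNat I.n ++ (encNat I.d ++ encList encIneq I.φ)

theorem isPrefixCode_encEvent {n d : ℕ} : IsPrefixCode (encEvent (n := n) (d := d)) := by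
  intro a
  induction a with
  | atom V v =>
    intro b s t h
    cases b <;> simp [encEvent] at h
    obtain ⟨h1, h⟩ := isPrefixCode_encNat _ _ _ _ h
    obtain ⟨h2, h⟩ := isPrefixCode_encNat _ _ _ _ h
    exact ⟨by rw [Fin.ext h1, Fin.ext h2], h⟩
  | neg a ih =>
    intro b s t h
    cases b <;> simp [encEvent] at h
    obtain ⟨h1, h⟩ := ih _ _ _ h
    exact ⟨by rw [h1], h⟩
  | and a₁ a₂ ih₁ ih₂ =>
    intro b s t h
    cases b <;> simp [encEvent] at h
    obtain ⟨h1, h⟩ := ih₁ _ _ _ h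
    obtain ⟨h2, h⟩ := ih₂ _ _ _ h
    exact ⟨by rw [h1, h2], h⟩

theorem isPrefixCode_encIneq {n d : ℕ} : IsPrefixCode (encIneq (n := n) (d := d)) := by
  rintro ⟨a₁, a₂⟩ ⟨b₁, b₂⟩ s t h
  simp only [encIneq, List.append_assoc] at h
  obtain ⟨h1, h'⟩ := isPrefixCode_encEvent _ _ _ _ h
  obtain ⟨h2, h3⟩ := isPrefixCode_encEvent _ _ _ _ h'
  exact ⟨by rw [h1, h2], h3⟩

theorem encSatInstance_injective : Function.Injective encSatInstance := by
  rintro ⟨n, d, φ⟩ ⟨n', d', φ'⟩ h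
  obtain ⟨h1, h⟩ := isPrefixCode_encNat _ _ _ _ h
  obtain ⟨h2, h⟩ := isPrefixCode_encNat _ _ _ _ h
  dsimp only at h1 h2
  subst h1 h2
  obtain rfl := (isPrefixCode_encList isPrefixCode_encIneq).injective h
  rfl

/-- SAT(prob, base), with an arbitrary parameter attached to its instances. -/
def satProbBase (κ : SatInstance → ℕ) : ParamProblem where
  Inst := SatInstance
  Sym := Token
  finSym := inferInstance
  enc := encSatInstance
  enc_injective := encSatInstance_injective
  yes := SatInstance.Satisfiable
  param := κ

end CausalSat

/-!
A circuit of depth at most `h`, for a constant `h`, unrolls into a formula whose size is polynomial of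
a degree that depends on `h` only. So weighted satisfiability of such circuits reduces to
SAT(prob, base) without any normal form for circuits of weft one.

Given a circuit with inputs `0, …, N - 1` and a weight `k`, take the variables `0, …, k` and the values
`0, …, N`. The constraints say that variable `0` has the value `0` and that all values are distinct;
then the variables other than `0` select `k` inputs, input `j` being selected if some variable has the
value `j + 1`. The remaining constraint says that the unrolled circuit accepts this selection. All
constraints have the form `Pr(ε) ≤ Pr(⊥)`, and a system of such inequalities has a model if and only if
some assignment avoids all the events `ε` (`satisfiable_iff_exists_assignment`). The number of
variables is `k + 1`, and it bounds the treewidth (`treewidth_le`), so one reduction serves both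
parameters; `satisfiable_satOfCircuit_iff` is its correctness.

What remains is to compute the reduction by a machine. A small imperative language `StackProg` of stack
operations, tests and loops is compiled to machine code, and a program of polynomial running time can
be run on the output of any given machine (`FPTComputable.comp_stackProg`); since stacks grow at most
linearly with time, the resulting time is again bounded by a computable function of the parameter
times a polynomial. This also provides the composition of the given reduction to circuits with the
reduction to SAT(prob, base). Unrolling is done in `h + 1` rounds on a text in which a hole, the token
`next` followed by a node number, stands for the value of a node: each round replaces all holes by
entries of a table that holds the formulas of all nodes in terms of earlier ones. Only nodes of depth
less than `h + 1 - t` are left in holes after `t` rounds, and each round multiplies the length of the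
text at most by
one more than the length of the table. `within_reductionProg` puts this together.
-/

namespace CausalSat

open Function Turing

/-! ### A language of stack programs -/

/-- Programs over a family `κ` of stacks with entries in `α`. The program `mv k ks` pops an entry of
the stack `k` and pushes it on all stacks in `ks`; tests look at the top entry of one stack. -/
inductive StackProg (κ α : Type) where
  | push (k : κ) (a : α)
  | mv (k : κ) (ks : List κ)
  | seq (p q : StackProg κ α)
  | ite (k : κ) (S : Option α → Bool) (p q : StackProg κ α)
  | loop (k : κ) (S : Option α → Bool) (p : StackProg κ α)

namespace StackProg

variable {κ α : Type} [DecidableEq κ]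

/-- Push `a` on all the stacks in the list. -/
def pushAll (a : α) : List κ → (κ → List α) → κ → List α
  | [], σ => σ
  | k :: ks, σ => pushAll a ks (update σ k (a :: σ k))

/-- `Runs p σ σ' t`: the program `p` turns the stack contents `σ` into `σ'` with `t` elementary
operations. Popping from an empty stack is not allowed. -/
inductive Runs : StackProg κ α → (κ → List α) → (κ → List α) → ℕ → Prop
  | push (k a σ) : Runs (push k a) σ (update σ k (a :: σ k)) 1
  | mv {k ks σ a l} (h : σ k = a :: l) : Runs (mv k ks) σ (pushAll a ks (update σ k l)) 1
  | seq {p q σ₁ σ₂ σ₃ s t} (h₁ : Runs p σ₁ σ₂ s) (h₂ : Runs q σ₂ σ₃ t) :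
      Runs (seq p q) σ₁ σ₃ (s + t)
  | ite_pos {k S p q σ σ' t} (hS : S (σ k).head? = true) (h : Runs p σ σ' t) :
      Runs (ite k S p q) σ σ' (t + 1)
  | ite_neg {k S p q σ σ' t} (hS : S (σ k).head? = false) (h : Runs q σ σ' t) :
      Runs (ite k S p q) σ σ' (t + 1)
  | loop_done {k S p σ} (hS : S (σ k).head? = false) : Runs (loop k S p) σ σ 1
  | loop_step {k S p σ₁ σ₂ σ₃ s t} (hS : S (σ₁ k).head? = true) (h₁ : Runs p σ₁ σ₂ s)
      (h₂ : Runs (loop k S p) σ₂ σ₃ t) : Runs (loop k S p) σ₁ σ₃ (s + t + 1)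

/-! ### Compilation of stack programs -/

/-- The control points of a program. -/
def Label : StackProg κ α → Type
  | push _ _ => Unit
  | mv _ _ => Unit
  | seq p q => Label p ⊕ Label q
  | ite _ _ p q => Option (Label p ⊕ Label q)
  | loop _ _ p => Option (Label p)

instance finite_label (p : StackProg κ α) : Finite p.Label := by
  induction p with
  | push => exact inferInstanceAs (Finite Unit)
  | mv => exact inferInstanceAs (Finite Unit)
  | seq p q hp hq => exact inferInstanceAs (Finite (p.Label ⊕ q.Label))
  | ite k S p q hp hq => exact inferInstanceAs (Finite (Option (p.Label ⊕ q.Label)))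
  | loop k S p hp => exact inferInstanceAs (Finite (Option p.Label))

/-- The control point at which a program starts. -/
def entry : (p : StackProg κ α) → p.Label
  | push _ _ => ()
  | mv _ _ => ()
  | seq p _ => Sum.inl (entry p)
  | ite _ _ _ _ => none
  | loop _ _ _ => none

section Compile

variable {K₁ : Type} (Γ₁ : K₁ → Type) (σ₁ : Type) {Λ : Type}

/-- The stack alphabets of a machine that has the stacks `K₁` besides those of a program. -/
abbrev SumAlphabet (κ α : Type) : K₁ ⊕ κ → Type := Sum.elim Γ₁ fun _ => α

/-- The statements of a machine with additional stacks and additional internal state. -/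
abbrev SumStmt (κ α Λ : Type) : Type := TM2.Stmt (SumAlphabet Γ₁ κ α) Λ (σ₁ × Option α)

variable {Γ₁ σ₁} [Inhabited α]

/-- Push the entry held in the internal state on all the stacks in the list. -/
def pushStmt (q : SumStmt Γ₁ σ₁ κ α Λ) : List κ → SumStmt Γ₁ σ₁ κ α Λ
  | [] => q
  | k :: ks => TM2.Stmt.push (Sum.inr k) (fun v => (v.2.getD default : α)) (pushStmt q ks)

/-- The machine code of a program: its control points are embedded by `emb` into the labels of the
machine, and control passes to `exit` at the end. -/
def code : (p : StackProg κ α) → (emb : p.Label → Λ) → (exit : Λ) → p.Label → SumStmt Γ₁ σ₁ κ α Λ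
  | push k a, _, exit, _ => TM2.Stmt.push (Sum.inr k) (fun _ => a) (TM2.Stmt.goto fun _ => exit)
  | mv k ks, _, exit, _ =>
      TM2.Stmt.pop (Sum.inr k) (fun v (o : Option α) => (v.1, o))
        (pushStmt (TM2.Stmt.goto fun _ => exit) ks)
  | seq p q, emb, _, Sum.inl l =>
      code p (fun l => emb (Sum.inl l)) (emb (Sum.inr (entry q))) l
  | seq _ q, emb, exit, Sum.inr l => code q (fun l => emb (Sum.inr l)) exit l
  | ite k S p q, emb, _, none =>
      TM2.Stmt.peek (Sum.inr k) (fun v (o : Option α) => (v.1, o))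
        (TM2.Stmt.branch (fun v => S v.2) (TM2.Stmt.goto fun _ => emb (some (Sum.inl (entry p))))
          (TM2.Stmt.goto fun _ => emb (some (Sum.inr (entry q)))))
  | ite _ _ p _, emb, exit, some (Sum.inl l) => code p (fun l => emb (some (Sum.inl l))) exit l
  | ite _ _ _ q, emb, exit, some (Sum.inr l) => code q (fun l => emb (some (Sum.inr l))) exit l
  | loop k S p, emb, exit, none =>
      TM2.Stmt.peek (Sum.inr k) (fun v (o : Option α) => (v.1, o))
        (TM2.Stmt.branch (fun v => S v.2) (TM2.Stmt.goto fun _ => emb (some (entry p)))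
          (TM2.Stmt.goto fun _ => exit))
  | loop _ _ p, emb, _, some l => code p (fun l => emb (some l)) (emb none) l

end Compile

end StackProg

/-- `Steps M c c' t`: the machine `M` gets from `c` to `c'` in exactly `t` steps. -/
def Steps {K : Type} [DecidableEq K] {Γ : K → Type} {Λ σ : Type} (M : Λ → TM2.Stmt Γ Λ σ)
    (c c' : TM2.Cfg Γ Λ σ) (t : ℕ) : Prop :=
  (flip bind (TM2.step M))^[t] (some c) = some c'

section Steps

variable {K : Type} [DecidableEq K] {Γ : K → Type} {Λ σ : Type} {M : Λ → TM2.Stmt Γ Λ σ}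

theorem Steps.refl (c : TM2.Cfg Γ Λ σ) : Steps M c c 0 := rfl

theorem Steps.trans {c₁ c₂ c₃ : TM2.Cfg Γ Λ σ} {s t : ℕ} (h₁ : Steps M c₁ c₂ s)
    (h₂ : Steps M c₂ c₃ t) : Steps M c₁ c₃ (s + t) := by
  unfold Steps at *
  rw [add_comm, iterate_add_apply, h₁, h₂]

theorem Steps.single {l : Λ} {v : σ} {S : ∀ k, List (Γ k)} {c : TM2.Cfg Γ Λ σ}
    (h : TM2.stepAux (M l) v S = c) : Steps M ⟨some l, v, S⟩ c 1 := by
  subst h; rfl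

theorem Steps.head {l : Λ} {v : σ} {S : ∀ k, List (Γ k)} {c : TM2.Cfg Γ Λ σ} {t : ℕ}
    (h : Steps M (TM2.stepAux (M l) v S) c t) : Steps M ⟨some l, v, S⟩ c (t + 1) := by
  rw [add_comm]
  exact (Steps.single rfl).trans h

end Steps

namespace StackProg

variable {κ α : Type} [DecidableEq κ] {K₁ : Type} [DecidableEq K₁] {Γ₁ : K₁ → Type} {σ₁ Λ : Type}

/-- Joint contents of two families of stacks. -/
def joinStk (S : ∀ k, List (Γ₁ k)) (σ : κ → List α) : ∀ k, List (SumAlphabet Γ₁ κ α k)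
  | Sum.inl k => S k
  | Sum.inr k => σ k

theorem update_joinStk_inr (S : ∀ k, List (Γ₁ k)) (σ : κ → List α) (k : κ) (l : List α) :
    update (joinStk S σ) (Sum.inr k) l = joinStk S (update σ k l) := by
  funext k'
  cases k' with
  | inl k' => rfl
  | inr k' =>
    by_cases h : k' = k
    · subst h
      exact (update_self (Sum.inr k') _ _).trans (update_self k' _ σ).symm
    · exact (update_of_ne (by simpa using h) _ _).trans (update_of_ne h _ σ).symm

theorem update_joinStk_inl (S : ∀ k, List (Γ₁ k)) (σ : κ → List α) (k : K₁) (l : List (Γ₁ k)) :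
    update (joinStk S σ) (Sum.inl k) l = joinStk (update S k l) σ := by
  funext k'
  cases k' with
  | inr k' => rfl
  | inl k' =>
    by_cases h : k' = k
    · subst h
      exact (update_self (Sum.inl k') _ _).trans (update_self k' _ S).symm
    · exact (update_of_ne (by simpa using h) _ _).trans (update_of_ne h _ S).symm

variable [Inhabited α]

theorem stepAux_pushStmt (q : SumStmt Γ₁ σ₁ κ α Λ) (ks : List κ) (v : σ₁) (a : α)
    (S : ∀ k, List (Γ₁ k)) (σ : κ → List α) :
    TM2.stepAux (pushStmt q ks) (v, some a) (joinStk S σ) =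
      TM2.stepAux q (v, some a) (joinStk S (pushAll a ks σ)) := by
  induction ks generalizing σ with
  | nil => rfl
  | cons k ks ih =>
    rw [pushAll, ← ih, ← update_joinStk_inr]
    rfl

/-- Machine code simulates a program step by step, whatever the other stacks and the rest of the
machine are. -/
theorem Runs.steps {p : StackProg κ α} {σ σ' : κ → List α} {t : ℕ} (h : Runs p σ σ' t)
    (M : Λ → SumStmt Γ₁ σ₁ κ α Λ) (S : ∀ k, List (Γ₁ k)) (v : σ₁) :
    ∀ (emb : p.Label → Λ) (exit : Λ), (∀ l, M (emb l) = code p emb exit l) →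
      ∀ w : Option α, ∃ w', Steps M ⟨some (emb p.entry), (v, w), joinStk S σ⟩
        ⟨some exit, (v, w'), joinStk S σ'⟩ t := by
  induction h with
  | push k a σ =>
    intro emb exit hM w
    refine ⟨w, Steps.single ?_⟩
    rw [hM, ← update_joinStk_inr]
    rfl
  | @mv k ks σ a l h =>
    intro emb exit hM w
    refine ⟨some a, Steps.single ?_⟩
    rw [hM]
    refine Eq.trans (b := TM2.stepAux (pushStmt (TM2.Stmt.goto fun _ => exit) ks) (v, (σ k).head?)
      (update (joinStk S σ) (Sum.inr k) (σ k).tail)) rfl ?_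
    rw [update_joinStk_inr, h, List.head?_cons, List.tail_cons, stepAux_pushStmt]
    rfl
  | seq h₁ h₂ ih₁ ih₂ =>
    intro emb exit hM w
    obtain ⟨w₁, h₁⟩ := ih₁ (fun l => emb (Sum.inl l)) _ (fun l => hM (Sum.inl l)) w
    obtain ⟨w₂, h₂⟩ := ih₂ (fun l => emb (Sum.inr l)) _ (fun l => hM (Sum.inr l)) w₁
    exact ⟨w₂, h₁.trans h₂⟩
  | @ite_pos k R p q σ σ' t hS h ih =>
    intro emb exit hM w
    obtain ⟨w₁, h₁⟩ := ih (fun l => emb (some (Sum.inl l))) exit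
      (fun l => hM (some (Sum.inl l))) (σ k).head?
    refine ⟨w₁, Steps.head ?_⟩
    convert h₁ using 1
    rw [hM]
    simp [entry, code, TM2.stepAux, joinStk, hS]
  | @ite_neg k R p q σ σ' t hS h ih =>
    intro emb exit hM w
    obtain ⟨w₁, h₁⟩ := ih (fun l => emb (some (Sum.inr l))) exit
      (fun l => hM (some (Sum.inr l))) (σ k).head?
    refine ⟨w₁, Steps.head ?_⟩
    convert h₁ using 1
    rw [hM]
    simp [entry, code, TM2.stepAux, joinStk, hS]
  | @loop_done k R p σ hS =>
    intro emb exit hM w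
    refine ⟨(σ k).head?, Steps.single ?_⟩
    rw [hM]
    simp [entry, code, TM2.stepAux, joinStk, hS]
  | @loop_step k R p σ₁ σ₂ σ₃ s t hS h₁ h₂ ih₁ ih₂ =>
    intro emb exit hM w
    obtain ⟨w₁, h₁⟩ := ih₁ (fun l => emb (some l)) (emb none)
      (fun l => hM (some l)) (σ₁ k).head?
    obtain ⟨w₂, h₂⟩ := ih₂ emb exit hM w₁
    refine ⟨w₂, Steps.head ?_⟩
    convert h₁.trans h₂ using 1
    rw [hM]
    simp [entry, code, TM2.stepAux, joinStk, hS]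

end StackProg

/-! ### Running a program on the output of a machine -/

section Lift

open StackProg

variable {κ α : Type} [DecidableEq κ] {K₁ : Type} [DecidableEq K₁] {Γ₁ : K₁ → Type} {σ₁ Λ₁ Λ : Type}

/-- A statement of a machine as a statement of a larger machine, where halting means going to
`exit`. -/
def liftStmt (emb : Λ₁ → Λ) (exit : Λ) : TM2.Stmt Γ₁ Λ₁ σ₁ → SumStmt Γ₁ σ₁ κ α Λ
  | .push k f q => .push (Sum.inl k) (fun v => f v.1) (liftStmt emb exit q)
  | .peek k f q => .peek (Sum.inl k) (fun v (o : Option (Γ₁ k)) => (f v.1 o, v.2))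
      (liftStmt emb exit q)
  | .pop k f q => .pop (Sum.inl k) (fun v (o : Option (Γ₁ k)) => (f v.1 o, v.2))
      (liftStmt emb exit q)
  | .load f q => .load (fun v => (f v.1, v.2)) (liftStmt emb exit q)
  | .branch f q₁ q₂ => .branch (fun v => f v.1) (liftStmt emb exit q₁) (liftStmt emb exit q₂)
  | .goto f => .goto fun v => emb (f v.1)
  | .halt => .goto fun _ => exit

/-- A configuration of a machine as a configuration of a larger machine. -/
def liftCfg (emb : Λ₁ → Λ) (exit : Λ) (σ : κ → List α) (w : Option α) (c : TM2.Cfg Γ₁ Λ₁ σ₁) :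
    TM2.Cfg (SumAlphabet Γ₁ κ α) Λ (σ₁ × Option α) :=
  ⟨some (c.l.elim exit emb), (c.var, w), joinStk c.stk σ⟩

theorem stepAux_liftStmt (emb : Λ₁ → Λ) (exit : Λ) (σ : κ → List α) (w : Option α)
    (q : TM2.Stmt Γ₁ Λ₁ σ₁) (v : σ₁) (S : ∀ k, List (Γ₁ k)) :
    TM2.stepAux (liftStmt emb exit q) (v, w) (joinStk S σ) =
      liftCfg emb exit σ w (TM2.stepAux q v S) := by
  induction q generalizing v S with
  | push k f q ih =>
    rw [TM2.stepAux, ← ih, ← update_joinStk_inl]; rfl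
  | peek k f q ih =>
    rw [TM2.stepAux, ← ih]; rfl
  | pop k f q ih =>
    rw [TM2.stepAux, ← ih, ← update_joinStk_inl]; rfl
  | load f q ih =>
    rw [TM2.stepAux, ← ih]; rfl
  | branch f q₁ q₂ ih₁ ih₂ =>
    simp only [liftStmt, TM2.stepAux]
    cases f v
    · exact ih₂ v S
    · exact ih₁ v S
  | goto f => rfl
  | halt => rfl

theorem steps_liftCfg {M₁ : Λ₁ → TM2.Stmt Γ₁ Λ₁ σ₁} {M : Λ → SumStmt Γ₁ σ₁ κ α Λ} {emb : Λ₁ → Λ}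
    {exit : Λ} (hM : ∀ l, M (emb l) = liftStmt emb exit (M₁ l)) (σ : κ → List α) (w : Option α)
    {c c' : TM2.Cfg Γ₁ Λ₁ σ₁} {t : ℕ} (h : Steps M₁ c c' t) :
    Steps M (liftCfg emb exit σ w c) (liftCfg emb exit σ w c') t := by
  induction t generalizing c with
  | zero =>
    obtain rfl : c = c' := by simpa [Steps] using h
    exact Steps.refl _
  | succ t ih =>
    obtain ⟨l, v, S⟩ := c
    cases l with
    | none =>
      -- a halted machine makes no further steps
      exfalso
      have h0 : ∀ s, (flip bind (TM2.step M₁))^[s] none = none := by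
        intro s
        induction s with
        | zero => rfl
        | succ s ihs => rw [iterate_succ_apply]; exact ihs
      rw [Steps, iterate_succ_apply] at h
      exact absurd ((h0 t).symm.trans h) (by simp)
    | some l =>
      refine Steps.head (t := t) ?_
      change Steps M (TM2.stepAux (M (emb l)) (v, w) (joinStk S σ)) _ _
      rw [hM, stepAux_liftStmt]
      exact ih h

/-- The number of push operations in a statement; those in both branches of a test are counted. -/
def pushCount : TM2.Stmt Γ₁ Λ₁ σ₁ → ℕ
  | .push _ _ q => pushCount q + 1
  | .peek _ _ q => pushCount q
  | .pop _ _ q => pushCount q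
  | .load _ q => pushCount q
  | .branch _ q₁ q₂ => pushCount q₁ + pushCount q₂
  | .goto _ => 0
  | .halt => 0

/-- A single step may push several entries, but no more than its statement has push operations. -/
theorem length_stepAux_le (q : TM2.Stmt Γ₁ Λ₁ σ₁) (v : σ₁) (S : ∀ k, List (Γ₁ k)) (k : K₁) :
    ((TM2.stepAux q v S).stk k).length ≤ (S k).length + pushCount q := by
  induction q generalizing v S with
  | push k' f q ih =>
    refine (ih _ _).trans ?_
    by_cases h : k = k'
    · subst h; simp [pushCount]; omega
    · simp [h, pushCount]
  | peek k' f q ih => exact ih _ _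
  | pop k' f q ih =>
    refine (ih _ _).trans ?_
    by_cases h : k = k'
    · subst h; simp [pushCount]
    · simp [h, pushCount]
  | load f q ih => exact ih _ _
  | branch f q₁ q₂ ih₁ ih₂ =>
    simp only [TM2.stepAux, pushCount]
    cases f v
    · exact (ih₂ _ _).trans (by omega)
    · exact (ih₁ _ _).trans (by omega)
  | goto f => simp [TM2.stepAux]
  | halt => simp [TM2.stepAux]

/-- Stacks grow at most linearly with the number of steps. -/
theorem length_stk_le_of_steps {M₁ : Λ₁ → TM2.Stmt Γ₁ Λ₁ σ₁} {B : ℕ} (hB : ∀ l, pushCount (M₁ l) ≤ B)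
    {c c' : TM2.Cfg Γ₁ Λ₁ σ₁} {t : ℕ} (h : Steps M₁ c c' t) (k : K₁) :
    (c'.stk k).length ≤ (c.stk k).length + B * t := by
  induction t generalizing c' with
  | zero =>
    obtain rfl : c = c' := by simpa [Steps] using h
    simp
  | succ t ih =>
    rw [Steps, iterate_succ_apply'] at h
    cases h1 : (flip bind (TM2.step M₁))^[t] (some c) with
    | none => rw [h1] at h; exact absurd h (by simp [flip])
    | some d =>
      rw [h1] at h
      have h2 := ih h1
      obtain ⟨l, v, S⟩ := d
      cases l with
      | none => exact absurd h (by simp [flip, TM2.step])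
      | some l =>
        have h3 : TM2.stepAux (M₁ l) v S = c' := by simpa [flip, TM2.step] using h
        rw [← h3]
        have h4 := length_stepAux_le (M₁ l) v S k
        have h5 := hB l
        simp only at h2
        rw [Nat.mul_succ]
        omega

end Lift

namespace StackProg

variable {κ α : Type} [DecidableEq κ] [Inhabited α]

/-- The statement that moves one entry of the stack `k₁`, recoded by `e`, onto the stack `inp`, and
that passes control to `exit` if there is none. -/
def transferStmt {K₁ : Type} {Γ₁ : K₁ → Type} {σ₁ Λ : Type} (k₁ : K₁) (e : Γ₁ k₁ ≃ α) (inp : κ)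
    (again exit : Λ) : SumStmt Γ₁ σ₁ κ α Λ :=
  .pop (Sum.inl k₁) (fun v (o : Option (Γ₁ k₁)) => (v.1, o.map e))
    (.branch (fun v => v.2.isSome)
      (.push (Sum.inr inp) (fun v => (v.2.getD default : α)) (.goto fun _ => again))
      (.goto fun _ => exit))

/-- The code that runs the machine `M₁`, moves its output in reverse onto the stack `inp` of a
program, runs the program, resets the internal state to `v₀` and halts. -/
def composeCode {K₁ : Type} {Γ₁ : K₁ → Type} {σ₁ Λ₁ : Type} (M₁ : Λ₁ → TM2.Stmt Γ₁ Λ₁ σ₁)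
    (v₀ : σ₁) (k₁ : K₁) (e : Γ₁ k₁ ≃ α) (p : StackProg κ α) (inp : κ) :
    Λ₁ ⊕ (Bool ⊕ p.Label) → SumStmt Γ₁ σ₁ κ α (Λ₁ ⊕ (Bool ⊕ p.Label))
  | Sum.inl l => liftStmt Sum.inl (Sum.inr (Sum.inl true)) (M₁ l)
  | Sum.inr (Sum.inl true) =>
      transferStmt k₁ e inp (Sum.inr (Sum.inl true)) (Sum.inr (Sum.inr p.entry))
  | Sum.inr (Sum.inl false) => .load (fun _ => (v₀, none)) .halt
  | Sum.inr (Sum.inr l) => code p (fun l => Sum.inr (Sum.inr l)) (Sum.inr (Sum.inl false)) l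

section

variable {K₁ : Type} [DecidableEq K₁] {Γ₁ : K₁ → Type} {σ₁ Λ₁ Λ : Type}

theorem stepAux_transferStmt_nil {k₁ : K₁} (e : Γ₁ k₁ ≃ α) (inp : κ) (again exit : Λ) (v : σ₁)
    (w : Option α) {S : ∀ k, List (Γ₁ k)} (σ : κ → List α) (h : S k₁ = []) :
    TM2.stepAux (transferStmt k₁ e inp again exit) (v, w) (joinStk S σ) =
      ⟨some exit, (v, none), joinStk S σ⟩ := by
  refine Eq.trans (b := TM2.stepAux (.branch (fun v => v.2.isSome)
      (.push (Sum.inr inp) (fun v => (v.2.getD default : α)) (.goto fun _ => again))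
      (.goto fun _ => exit)) (v, (S k₁).head?.map e)
        (update (joinStk S σ) (Sum.inl k₁) (S k₁).tail)) rfl ?_
  rw [update_joinStk_inl, h, List.tail_nil, ← h, update_eq_self, h]
  rfl

theorem stepAux_transferStmt_cons {k₁ : K₁} (e : Γ₁ k₁ ≃ α) (inp : κ) (again exit : Λ) (v : σ₁)
    (w : Option α) {S : ∀ k, List (Γ₁ k)} (σ : κ → List α) {b : Γ₁ k₁} {l : List (Γ₁ k₁)}
    (h : S k₁ = b :: l) :
    TM2.stepAux (transferStmt k₁ e inp again exit) (v, w) (joinStk S σ) =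
      ⟨some again, (v, some (e b)), joinStk (update S k₁ l) (update σ inp (e b :: σ inp))⟩ := by
  refine Eq.trans (b := TM2.stepAux (.branch (fun v => v.2.isSome)
      (.push (Sum.inr inp) (fun v => (v.2.getD default : α)) (.goto fun _ => again))
      (.goto fun _ => exit)) (v, (S k₁).head?.map e)
        (update (joinStk S σ) (Sum.inl k₁) (S k₁).tail)) rfl ?_
  rw [update_joinStk_inl, h, List.tail_cons, ← update_joinStk_inr]
  rfl

/-- The running time of a machine followed by a program. -/
theorem steps_composeCode {M₁ : Λ₁ → TM2.Stmt Γ₁ Λ₁ σ₁} {v₀ : σ₁} {k₁ : K₁} (e : Γ₁ k₁ ≃ α)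
    {p : StackProg κ α} {inp : κ} {σ : κ → List α} {c : TM2.Cfg Γ₁ Λ₁ σ₁} {y : List α} {t₁ t₂ : ℕ}
    (h₁ : Steps M₁ c ⟨none, v₀, update (fun _ => []) k₁ (y.map e.symm)⟩ t₁)
    (h₂ : Runs p (update (fun _ => []) inp y.reverse) σ t₂) :
    Steps (composeCode M₁ v₀ k₁ e p inp)
      (liftCfg Sum.inl (Sum.inr (Sum.inl true)) (fun _ => []) none c)
      ⟨none, (v₀, none), joinStk (fun _ => []) σ⟩ (t₁ + (y.length + 1) + t₂ + 1) := by
  have main := steps_liftCfg (M := composeCode M₁ v₀ k₁ e p inp) (emb := Sum.inl)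
    (exit := Sum.inr (Sum.inl true)) (fun l => rfl) (fun _ : κ => ([] : List α)) none h₁
  have transfer : ∀ (y : List α) (σ : κ → List α) (w : Option α),
      ∃ w', Steps (composeCode M₁ v₀ k₁ e p inp)
        ⟨some (Sum.inr (Sum.inl true)), (v₀, w),
          joinStk (update (fun _ => []) k₁ (y.map e.symm)) σ⟩
        ⟨some (Sum.inr (Sum.inr p.entry)), (v₀, w'),
          joinStk (fun _ => []) (update σ inp (y.reverse ++ σ inp))⟩ (y.length + 1) := by
    intro y
    induction y with
    | nil =>
      intro σ w
      refine ⟨none, Steps.single ?_⟩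
      refine (stepAux_transferStmt_nil e inp _ _ v₀ w σ (by simp)).trans ?_
      simp
    | cons a y ih =>
      intro σ w
      obtain ⟨w', h⟩ := ih (update σ inp (a :: σ inp)) (some a)
      refine ⟨w', ?_⟩
      rw [List.length_cons]
      refine Steps.head (t := y.length + 1) ?_
      convert h using 1
      · refine (stepAux_transferStmt_cons e inp _ _ v₀ w σ (b := e.symm a)
          (l := y.map e.symm) (by simp)).trans ?_
        simp
      · simp
  obtain ⟨w₁, ht⟩ := transfer y (fun _ => []) none
  rw [List.append_nil] at ht
  obtain ⟨w₂, hp⟩ := h₂.steps (composeCode M₁ v₀ k₁ e p inp) (fun _ => []) v₀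
    (fun l => Sum.inr (Sum.inr l)) (Sum.inr (Sum.inl false)) (fun l => rfl) w₁
  exact ((main.trans ht).trans hp).trans (Steps.single rfl)

end

/-- Run a machine, move its output in reverse onto the stack `inp` of a program and run the
program, with the output on the stack `out`. -/
noncomputable def composeMachine [Fintype κ] (tm : FinTM2) (e : tm.Γ tm.k₁ ≃ α) [Finite α]
    (p : StackProg κ α) (inp out : κ) : FinTM2 :=
  letI := tm.kDecidableEq
  letI := tm.kFin
  letI := tm.ΛFin
  letI := tm.σFin
  letI := Fintype.ofFinite p.Label
  letI := Fintype.ofFinite α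
  { K := tm.K ⊕ κ
    k₀ := Sum.inl tm.k₀
    k₁ := Sum.inr out
    Γ := SumAlphabet tm.Γ κ α
    Λ := tm.Λ ⊕ (Bool ⊕ p.Label)
    main := Sum.inl tm.main
    σ := tm.σ × Option α
    initialState := (tm.initialState, none)
    Γk₀Fin := tm.Γk₀Fin
    m := composeCode tm.m tm.initialState tm.k₁ e p inp }

/-- The stacks of the initial configuration, without the casts of its definition. -/
theorem stk_initList (tm : FinTM2) (s : List (tm.Γ tm.k₀)) :
    (initList tm s).stk = update (fun _ => []) tm.k₀ s := by
  funext k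
  by_cases h : k = tm.k₀
  · subst h; simp [initList]
  · simp [initList, h]

theorem stk_haltList (tm : FinTM2) (s : List (tm.Γ tm.k₁)) :
    (haltList tm s).stk = update (fun _ => []) tm.k₁ s := by
  funext k
  by_cases h : k = tm.k₁
  · subst h; simp [haltList]
  · simp [haltList, h]

theorem cfg_ext {K : Type} {Γ : K → Type} {Λ σ : Type} {c c' : TM2.Cfg Γ Λ σ} (h₁ : c.l = c'.l)
    (h₂ : c.var = c'.var) (h₃ : c.stk = c'.stk) : c = c' := by
  cases c; cases c'; simp_all

theorem steps_composeMachine [Fintype κ] [Finite α] (tm : FinTM2) (e : tm.Γ tm.k₁ ≃ α)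
    (p : StackProg κ α) (inp out : κ) {s : List (tm.Γ tm.k₀)} {y z : List α} {t₁ t₂ : ℕ}
    (h₁ : Steps tm.m (initList tm s) (haltList tm (y.map e.symm)) t₁)
    (h₂ : Runs p (update (fun _ => []) inp y.reverse) (update (fun _ => []) out z) t₂) :
    Steps (composeMachine tm e p inp out).m (initList (composeMachine tm e p inp out) s)
      (haltList (composeMachine tm e p inp out) z) (t₁ + (y.length + 1) + t₂ + 1) := by
  let := tm.kDecidableEq
  have e₀ : haltList tm (y.map e.symm) =
      ⟨none, tm.initialState, update (fun _ => []) tm.k₁ (y.map e.symm)⟩ :=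
    cfg_ext rfl rfl (stk_haltList tm _)
  have e₁ : initList (composeMachine tm e p inp out) s = liftCfg Sum.inl (Sum.inr (Sum.inl true))
      (fun _ : κ => ([] : List α)) none (initList tm s) := by
    refine cfg_ext rfl rfl ((stk_initList _ _).trans ?_)
    refine Eq.trans (b := update (joinStk (fun _ => []) fun _ => []) (Sum.inl tm.k₀) s) ?_ ?_
    · congr 1
      funext k
      cases k <;> rfl
    · exact (update_joinStk_inl _ _ _ _).trans (congrArg (joinStk · _) (stk_initList tm s).symm)
  have e₂ : haltList (composeMachine tm e p inp out) z = ⟨none, (tm.initialState, none),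
      joinStk (fun _ => []) (update (fun _ : κ => ([] : List α)) out z)⟩ := by
    refine cfg_ext rfl rfl ((stk_haltList _ _).trans ?_)
    refine Eq.trans (b := update (joinStk (fun _ => []) fun _ => []) (Sum.inr out) z) ?_
      (update_joinStk_inr _ _ _ _)
    congr 1
    funext k
    cases k <;> rfl
  rw [e₀] at h₁
  rw [e₁, e₂]
  exact steps_composeCode e h₁ h₂

end StackProg

/-- A stack program of polynomial running time can be appended to a parameterized computation. The
program finds its input in reverse on the stack `inp` and leaves its output on the stack `out`. -/
theorem FPTComputable.comp_stackProg {P Q R : ParamProblem} {r₁ : P.Inst → Q.Inst}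
    (h₁ : FPTComputable P Q r₁) {κ : Type} [DecidableEq κ] [Fintype κ] [Inhabited R.Sym]
    (r₂ : Q.Inst → R.Inst) (ι : Q.Sym ≃ R.Sym) (p : StackProg κ R.Sym) (inp out : κ) (C e : ℕ)
    (h₂ : ∀ b, ∃ t ≤ C * ((Q.enc b).length + 1) ^ e,
      p.Runs (update (fun _ => []) inp (((Q.enc b).map ι).reverse))
        (update (fun _ => []) out (R.enc (r₂ b))) t) :
    FPTComputable P R (r₂ ∘ r₁) := by
  obtain ⟨M, f, q, hf, hM⟩ := h₁
  have := R.finSym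
  let := M.tm.ΛFin
  obtain ⟨B, hB⟩ : ∃ B, ∀ l, pushCount (M.tm.m l) ≤ B :=
    ⟨Finset.univ.sup fun l => pushCount (M.tm.m l),
      fun l => Finset.le_sup (f := fun l => pushCount (M.tm.m l)) (Finset.mem_univ l)⟩
  let ee : M.tm.Γ M.tm.k₁ ≃ R.Sym := M.outputAlphabet.trans ι
  let g : Polynomial ℕ := Polynomial.X + 1 + Polynomial.C B * q
  refine ⟨⟨StackProg.composeMachine M.tm ee p inp out, M.inputAlphabet, Equiv.refl R.Sym⟩,
    -- the output of the given machine has length less than `(f k + 1) * g |a|`, because its stacks grow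
    -- by at most `B` entries per step
    fun k => (f k + 1) ^ (e + 1), q + g + Polynomial.C C * g ^ e + 1, ?_, fun a => ?_⟩
  · have hpow : ∀ m : ℕ, Computable fun k => (f k + 1) ^ m := by
      intro m
      induction m with
      | zero => simpa using Computable.const 1
      | succ m ih =>
        simp only [pow_succ]
        exact (Primrec.nat_mul.to_comp).comp ih (Computable.succ.comp hf)
    exact hpow _
  · obtain ⟨⟨⟨t₁, ht⟩, ht₁⟩⟩ := hM a
    set n := (P.enc a).length with hn
    set y := Q.enc (r₁ a) with hy
    obtain ⟨t₂, ht₂, hp⟩ := h₂ (r₁ a)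
    have hsteps : Steps M.tm.m (initList M.tm ((P.enc a).map M.inputAlphabet.symm))
        (haltList M.tm ((y.map ι).map ee.symm)) t₁ := by
      have : (y.map ι).map ee.symm = y.map M.outputAlphabet.symm := by
        rw [List.map_map]
        refine List.map_congr_left fun x _ => ?_
        simp [ee]
      rw [this]
      exact ht
    have hlen : y.length ≤ n + B * t₁ := by
      have := length_stk_le_of_steps hB hsteps M.tm.k₁
      rw [StackProg.stk_haltList, StackProg.stk_initList, update_self] at this
      simp only [List.length_map] at this
      refine this.trans ?_
      gcongr
      by_cases hk : M.tm.k₁ = M.tm.k₀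
      · have h3 : ∀ k, k = M.tm.k₀ → (update (fun _ => []) M.tm.k₀
            ((P.enc a).map M.inputAlphabet.symm) k).length = n := by
          rintro k rfl
          simp [hn]
        exact (h3 _ hk).le
      · simp [hk]
    have hfin := StackProg.steps_composeMachine M.tm ee p inp out hsteps hp
    refine ⟨⟨⟨t₁ + ((y.map ι).length + 1) + t₂ + 1, ?_⟩, ?_⟩⟩
    · have hz : (R.enc (r₂ (r₁ a))).map (Equiv.refl R.Sym).symm = R.enc (r₂ (r₁ a)) :=
        List.map_id _
      exact Eq.trans hfin (congrArg (fun z => some (haltList _ z)) hz.symm)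
    · set F := f (P.param a) with hF
      set G := g.eval n with hG
      set q' := q.eval n with hq'
      have hG' : G = n + 1 + B * q' := by simp [hG, g, hq']
      have h4 : y.length + 1 ≤ (F + 1) * G := by
        rw [hG']
        have : B * t₁ ≤ B * (F * q') := Nat.mul_le_mul_left _ ht₁
        nlinarith [Nat.zero_le (F * n), Nat.zero_le (B * q')]
      have h5 : t₂ ≤ C * ((F + 1) * G) ^ e := ht₂.trans (by gcongr)
      have hF1 : 1 ≤ (F + 1) ^ e := Nat.one_le_pow _ _ (by omega)
      have e1 : F * q' ≤ (F + 1) ^ (e + 1) * q' := by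
        rw [pow_succ]; gcongr; nlinarith
      have e2 : (F + 1) * G ≤ (F + 1) ^ (e + 1) * G := by
        rw [pow_succ]; gcongr; nlinarith
      have e3 : C * ((F + 1) * G) ^ e ≤ (F + 1) ^ (e + 1) * (C * G ^ e) := by
        rw [mul_pow, pow_succ]
        have : (F + 1) ^ e * (C * G ^ e) ≤ (F + 1) ^ e * (F + 1) * (C * G ^ e) := by
          gcongr; nlinarith
        calc _ = (F + 1) ^ e * (C * G ^ e) := by ring
          _ ≤ _ := this
      have e4 : 1 ≤ (F + 1) ^ (e + 1) := Nat.one_le_pow _ _ (by omega)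
      have e5 : t₁ ≤ F * q' := ht₁
      have key : t₁ + (y.length + 1) + t₂ + 1 ≤ (F + 1) ^ (e + 1) * (q' + G + C * G ^ e + 1) := by
        rw [mul_add, mul_add, mul_add, mul_one]
        omega
      simpa using key

end CausalSat

namespace CausalSat

/-! ### Formulas with holes for the nodes of a circuit -/

/-- Events in which some subformulas are still to be filled in: `hole j` stands for the value of
node `j` of a circuit. Variables and values are natural numbers. -/
inductive Formula where
  | hole (j : ℕ)
  | atom (V v : ℕ)
  | neg (F : Formula)
  | and (F G : Formula)

namespace Formula

/-- The string of a formula; it extends the code of events to holes. -/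
def code : Formula → List Token
  | hole j => Token.next :: encNat j
  | atom V v => Token.atom :: (encNat V ++ encNat v)
  | neg F => Token.neg :: code F
  | and F G => Token.and :: (code F ++ code G)

/-- A formula that is always false. -/
def falsum : Formula := and (atom 0 0) (neg (atom 0 0))

/-- A formula that is always true. -/
def verum : Formula := neg falsum

/-- The conjunction of a list of formulas, closed by `verum`. -/
def conj : List Formula → Formula
  | [] => verum
  | F :: l => and F (conj l)

/-- Fill the holes of a formula. -/
def subst (f : ℕ → Formula) : Formula → Formula
  | hole j => f j
  | atom V v => atom V v
  | neg F => neg (subst f F)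
  | and F G => and (subst f F) (subst f G)

/-- The formula holds, given the truth of the holes and of the atoms. -/
def Holds (D : ℕ → Prop) (A : ℕ → ℕ → Prop) : Formula → Prop
  | hole j => D j
  | atom V v => A V v
  | neg F => ¬ Holds D A F
  | and F G => Holds D A F ∧ Holds D A G

/-- All atoms concern variables below `n` and values below `d`, and all holes satisfy `P`. -/
def Bounded (n d : ℕ) (P : ℕ → Prop) : Formula → Prop
  | hole j => P j
  | atom V v => V < n ∧ v < d
  | neg F => Bounded n d P F
  | and F G => Bounded n d P F ∧ Bounded n d P G

theorem not_holds_falsum (D : ℕ → Prop) (A : ℕ → ℕ → Prop) : ¬ falsum.Holds D A := by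
  simp [falsum, Holds]

theorem holds_verum (D : ℕ → Prop) (A : ℕ → ℕ → Prop) : verum.Holds D A :=
  not_holds_falsum D A

theorem holds_conj {D : ℕ → Prop} {A : ℕ → ℕ → Prop} {l : List Formula} :
    (conj l).Holds D A ↔ ∀ F ∈ l, F.Holds D A := by
  induction l with
  | nil => simp [conj, holds_verum]
  | cons F l ih => simp [conj, Holds, ih]

theorem holds_subst {D : ℕ → Prop} {A : ℕ → ℕ → Prop} {f : ℕ → Formula} {F : Formula} :
    (F.subst f).Holds D A ↔ F.Holds (fun j => (f j).Holds D A) A := by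
  induction F with
  | hole j => rfl
  | atom V v => rfl
  | neg F ih => simp [subst, Holds, ih]
  | and F G ihF ihG => simp [subst, Holds, ihF, ihG]

/-- The truth value depends only on the holes that may occur. -/
theorem Bounded.holds_congr {n d : ℕ} {P : ℕ → Prop} {D D' : ℕ → Prop} {A : ℕ → ℕ → Prop}
    {F : Formula} (hF : F.Bounded n d P) (h : ∀ j, P j → (D j ↔ D' j)) :
    F.Holds D A ↔ F.Holds D' A := by
  induction F with
  | hole j => exact h j hF
  | atom V v => rfl
  | neg F ih => simp [Holds, ih hF]
  | and F G ihF ihG => simp [Holds, ihF hF.1, ihG hF.2]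

theorem Bounded.mono {n d : ℕ} {P Q : ℕ → Prop} {F : Formula} (hF : F.Bounded n d P)
    (h : ∀ j, P j → Q j) : F.Bounded n d Q := by
  induction F with
  | hole j => exact h j hF
  | atom V v => exact hF
  | neg F ih => exact ih hF
  | and F G ihF ihG => exact ⟨ihF hF.1, ihG hF.2⟩

theorem Bounded.subst {n d : ℕ} {P Q : ℕ → Prop} {f : ℕ → Formula} {F : Formula}
    (hF : F.Bounded n d P) (h : ∀ j, P j → (f j).Bounded n d Q) : (F.subst f).Bounded n d Q := by
  induction F with
  | hole j => exact h j hF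
  | atom V v => exact hF
  | neg F ih => exact ih hF
  | and F G ihF ihG => exact ⟨ihF hF.1, ihG hF.2⟩

theorem bounded_falsum (n d : ℕ) (P : ℕ → Prop) : falsum.Bounded (n + 1) (d + 1) P := by
  simp [falsum, Bounded]

theorem bounded_conj {n d : ℕ} {P : ℕ → Prop} {l : List Formula}
    (h : ∀ F ∈ l, F.Bounded (n + 1) (d + 1) P) : (conj l).Bounded (n + 1) (d + 1) P := by
  induction l with
  | nil => exact bounded_falsum n d P
  | cons F l ih => exact ⟨h F (by simp), ih fun G hG => h G (by simp [hG])⟩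

theorem code_conj (l : List Formula) :
    (conj l).code = l.flatMap (fun F => Token.and :: F.code) ++ verum.code := by
  induction l with
  | nil => rfl
  | cons F l ih => simp [conj, code, ih]

/-- The event of a formula; it is meaningful if the formula has no holes and all its atoms are in
range. -/
def toEvent (n d : ℕ) : Formula → Event (n + 1) (d + 1)
  | hole _ => .atom 0 0
  | atom V v => .atom (Fin.ofNat _ V) (Fin.ofNat _ v)
  | neg F => .neg (toEvent n d F)
  | and F G => .and (toEvent n d F) (toEvent n d G)

theorem encEvent_toEvent {n d : ℕ} {F : Formula}
    (hF : F.Bounded (n + 1) (d + 1) fun _ => False) : encEvent (F.toEvent n d) = F.code := by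
  induction F with
  | hole j => exact hF.elim
  | atom V v => simp [toEvent, encEvent, code, Nat.mod_eq_of_lt hF.1, Nat.mod_eq_of_lt hF.2]
  | neg F ih => simp [toEvent, encEvent, code, ih hF]
  | and F G ihF ihG => simp [toEvent, encEvent, code, ihF hF.1, ihG hF.2]

theorem holds_toEvent {n d : ℕ} {F : Formula} (hF : F.Bounded (n + 1) (d + 1) fun _ => False)
    (s : Fin (n + 1) → Fin (d + 1)) (D : ℕ → Prop) :
    (F.toEvent n d).Holds s ↔ F.Holds D fun V v => s (Fin.ofNat _ V) = Fin.ofNat _ v := by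
  induction F with
  | hole j => exact hF.elim
  | atom V v => rfl
  | neg F ih => simp [toEvent, Event.Holds, Holds, ih hF]
  | and F G ihF ihG => simp [toEvent, Event.Holds, Holds, ihF hF.1, ihG hF.2]

end Formula

/-! ### Node data of a circuit -/

section NodeData

variable {α : Type} (step : List α → Gate → α)

theorem length_foldl_nodeData (init : List α) (gs : List Gate) :
    (gs.foldl (fun vals g => vals ++ [step vals g]) init).length = init.length + gs.length := by
  induction gs generalizing init with
  | nil => simp
  | cons g gs ih => simp [ih]; omega

theorem prefix_foldl_nodeData (init : List α) (gs : List Gate) :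
    init <+: gs.foldl (fun vals g => vals ++ [step vals g]) init := by
  induction gs generalizing init with
  | nil => simp
  | cons g gs ih => exact (List.prefix_append _ _).trans (ih _)

/-- The data of the inputs and of the gates before gate `i` form an initial segment of the node
data, from which the datum of gate `i` is computed. -/
theorem exists_prefix_nodeData (C : Circuit) {init : List α} (hinit : init.length = C.inputs)
    {i : ℕ} {g : Gate} (hg : C.gates[i]? = some g) :
    ∃ l, l <+: C.nodeData init step ∧ l.length = C.inputs + i ∧
      (C.nodeData init step)[C.inputs + i]? = some (step l g) := by
  have hi : i < C.gates.length := (List.getElem?_eq_some_iff.1 hg).1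
  have hgs : C.gates = C.gates.take i ++ g :: C.gates.drop (i + 1) := by
    rw [← (List.getElem?_eq_some_iff.1 hg).2, List.cons_getElem_drop_succ, List.take_append_drop]
  set l := (C.gates.take i).foldl (fun vals g => vals ++ [step vals g]) init with hl
  have hlen : l.length = C.inputs + i := by
    rw [hl, length_foldl_nodeData, hinit, List.length_take, min_eq_left hi.le]
  have hpre : l ++ [step l g] <+: C.nodeData init step := by
    rw [Circuit.nodeData, hgs, List.foldl_append, List.foldl_cons]
    exact prefix_foldl_nodeData step _ _
  refine ⟨l, (List.prefix_append _ _).trans hpre, hlen, ?_⟩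
  obtain ⟨m, hm⟩ := hpre
  rw [← hm, ← hlen]
  simp

theorem getD_nodeData_input (C : Circuit) {init : List α} {j : ℕ} (hj : j < init.length) (a : α) :
    (C.nodeData init step).getD j a = init.getD j a := by
  obtain ⟨m, hm⟩ := prefix_foldl_nodeData step init C.gates
  rw [Circuit.nodeData, ← hm]
  simp [List.getD, List.getElem?_append_left hj]

theorem getD_of_prefix {l m : List α} (h : l <+: m) {j : ℕ} (hj : j < l.length) (a : α) :
    l.getD j a = m.getD j a := by
  obtain ⟨r, rfl⟩ := h
  simp [List.getD, List.getElem?_append_left hj]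

end NodeData

namespace Circuit

variable (C : Circuit)

/-- The truth values of all nodes under an assignment to the inputs. -/
def nodeValue (x : Fin C.inputs → Bool) (j : ℕ) : Bool :=
  (C.nodeData (List.ofFn x) fun vals g => g.value vals).getD j false

/-- The depths of all nodes. -/
def nodeDepth (j : ℕ) : ℕ :=
  (C.nodeData (List.replicate C.inputs 0) fun data g => maxPred data g + 1).getD j 0

variable {C}

theorem nodeValue_input (x : Fin C.inputs → Bool) (j : Fin C.inputs) : C.nodeValue x j = x j := by
  rw [nodeValue, getD_nodeData_input _ _ (by simp)]
  simp [List.getD]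

theorem nodeValue_gate (hC : C.WellFormed) (x : Fin C.inputs → Bool) {i : ℕ} {g : Gate}
    (hg : C.gates[i]? = some g) : C.nodeValue x (C.inputs + i) =
      match g with
      | .neg j => !(C.nodeValue x j)
      | .and l => l.all (C.nodeValue x)
      | .or l => l.any (C.nodeValue x) := by
  obtain ⟨l, hl, hlen, h⟩ := exists_prefix_nodeData (fun vals g => g.value vals) C
    (init := List.ofFn x) (by simp) hg
  have hp := (hC.2 i g hg).2.2
  have key : ∀ j ∈ g.preds, l.getD j false = C.nodeValue x j := fun j hj =>
    getD_of_prefix hl (by rw [hlen]; exact hp j hj) _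
  rw [nodeValue, List.getD, h, Option.getD_some]
  cases g with
  | neg j => simp only [Gate.value]; rw [key j (by simp [Gate.preds])]
  | and m =>
    simp only [Gate.value]
    rw [Bool.eq_iff_iff, List.all_eq_true, List.all_eq_true]
    exact forall₂_congr fun j hj => by rw [key j hj]
  | or m =>
    simp only [Gate.value]
    rw [Bool.eq_iff_iff, List.any_eq_true, List.any_eq_true]
    exact exists_congr fun j => and_congr_right fun hj => by rw [key j hj]

theorem le_foldr_max {l : List ℕ} {a : ℕ} (h : a ∈ l) : a ≤ l.foldr max 0 := by
  induction l with
  | nil => simp at h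
  | cons b l ih =>
    rcases List.mem_cons.1 h with rfl | h
    · simp
    · exact (ih h).trans (by simp)

/-- Depth increases strictly along the wires, so unrolling stops. -/
theorem nodeDepth_lt (hC : C.WellFormed) {i : ℕ} {g : Gate} (hg : C.gates[i]? = some g) {j : ℕ}
    (hj : j ∈ g.preds) : C.nodeDepth j < C.nodeDepth (C.inputs + i) := by
  obtain ⟨l, hl, hlen, h⟩ := exists_prefix_nodeData (fun data g => maxPred data g + 1) C
    (init := List.replicate C.inputs 0) (by simp) hg
  have hp := (hC.2 i g hg).2.2 j hj
  have key : l.getD j 0 = C.nodeDepth j := getD_of_prefix hl (by rw [hlen]; exact hp) _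
  have h2 : C.nodeDepth (C.inputs + i) = maxPred l g + 1 := by
    rw [nodeDepth, List.getD, h, Option.getD_some]
  rw [h2, ← key, Nat.lt_succ_iff]
  exact le_foldr_max (List.mem_map_of_mem hj)

/-! ### Unrolling a circuit into a formula -/

/-- The formula of a gate over its in-neighbours. -/
def gateFormula : Gate → Formula
  | .neg j => .neg (.hole j)
  | .and l => .conj (l.map .hole)
  | .or l => .neg (.conj (l.map fun j => .neg (.hole j)))

/-- Input `j` is true if one of the variables `0, …, k` has the value `j + 1`. -/
def inputFormula (k j : ℕ) : Formula :=
  .neg (.conj ((List.range (k + 1)).map fun i => .neg (.atom i (j + 1))))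

variable (C)

/-- The formulas of all nodes in terms of earlier nodes. -/
def table (k : ℕ) : List Formula :=
  (List.range C.inputs).map (inputFormula k) ++ C.gates.map gateFormula

/-- The formula of node `j`. -/
def nodeFormula (k j : ℕ) : Formula := (C.table k).getD j .verum

/-- The output node, unrolled `t` times. -/
def unroll (k : ℕ) : ℕ → Formula
  | 0 => .hole C.out
  | t + 1 => (unroll k t).subst (C.nodeFormula k)

variable {C}

theorem length_table (k : ℕ) : (C.table k).length = C.inputs + C.gates.length := by
  simp [table]

theorem nodeFormula_input (k : ℕ) {j : ℕ} (hj : j < C.inputs) :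
    C.nodeFormula k j = inputFormula k j := by
  simp [nodeFormula, table, List.getD, List.getElem?_append_left, hj]

theorem nodeFormula_gate (k : ℕ) {i : ℕ} {g : Gate} (hg : C.gates[i]? = some g) :
    C.nodeFormula k (C.inputs + i) = gateFormula g := by
  simp [nodeFormula, table, List.getD, List.getElem?_append_right, hg]

theorem exists_gate {j : ℕ} (hj : j < C.inputs + C.gates.length) (h : ¬ j < C.inputs) :
    ∃ i g, j = C.inputs + i ∧ C.gates[i]? = some g :=
  ⟨j - C.inputs, C.gates[j - C.inputs], by omega, List.getElem?_eq_getElem _⟩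

/-- The nodes of depth less than `t`. -/
def Shallow (C : Circuit) (t j : ℕ) : Prop :=
  j < C.inputs + C.gates.length ∧ C.nodeDepth j < t

/-- The formula of a node of depth at most `t` has holes only for nodes of depth less than `t`. -/
theorem bounded_nodeFormula (hC : C.WellFormed) (k t : ℕ) {j : ℕ} (hj : C.Shallow (t + 1) j) :
    (C.nodeFormula k j).Bounded (k + 1) (C.inputs + 1) (C.Shallow t) := by
  by_cases h : j < C.inputs
  · rw [nodeFormula_input k h]
    refine Formula.bounded_conj (P := C.Shallow t) fun F hF => ?_
    obtain ⟨i, hi, rfl⟩ := List.mem_map.1 hF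
    exact ⟨List.mem_range.1 hi, by omega⟩
  · obtain ⟨i, g, rfl, hg⟩ := exists_gate hj.1 h
    have hi : i < C.gates.length := (List.getElem?_eq_some_iff.1 hg).1
    have key : ∀ j ∈ g.preds, C.Shallow t j := fun j hj' => by
      have h1 := (hC.2 i g hg).2.2 j hj'
      have h2 := nodeDepth_lt hC hg hj'
      have h3 := hj.2
      exact ⟨by omega, by omega⟩
    rw [nodeFormula_gate k hg]
    cases g with
    | neg j => exact key j (by simp [Gate.preds])
    | and l =>
      refine Formula.bounded_conj fun F hF => ?_
      obtain ⟨i, hi, rfl⟩ := List.mem_map.1 hF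
      exact key i hi
    | or l =>
      refine Formula.bounded_conj (P := C.Shallow t) fun F hF => ?_
      obtain ⟨i, hi, rfl⟩ := List.mem_map.1 hF
      exact key i hi

theorem bounded_unroll (hC : C.WellFormed) (k : ℕ) {h : ℕ} (hd : C.depth ≤ h) {t : ℕ}
    (ht : t ≤ h + 1) :
    (C.unroll k t).Bounded (k + 1) (C.inputs + 1) (C.Shallow (h + 1 - t)) := by
  induction t with
  | zero => exact ⟨hC.1, Nat.lt_succ_of_le hd⟩
  | succ t ih =>
    refine (ih (by omega)).subst fun j hj => bounded_nodeFormula hC k _ ?_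
    rwa [show h + 1 - (t + 1) + 1 = h + 1 - t by omega]

/-- If the circuit has depth at most `h`, then `h + 1` rounds of unrolling leave no holes. -/
theorem bounded_unroll_depth (hC : C.WellFormed) (k : ℕ) {h : ℕ} (hd : C.depth ≤ h) :
    (C.unroll k (h + 1)).Bounded (k + 1) (C.inputs + 1) fun _ => False :=
  (bounded_unroll hC k hd le_rfl).mono fun j hj => by
    have := hj.2
    omega

theorem holds_nodeFormula (hC : C.WellFormed) {k : ℕ} {x : Fin C.inputs → Bool}
    {A : ℕ → ℕ → Prop} (hx : ∀ j, x j = true ↔ ∃ i ≤ k, A i (j + 1)) {j : ℕ}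
    (hj : j < C.inputs + C.gates.length) :
    (C.nodeFormula k j).Holds (fun j => C.nodeValue x j = true) A ↔ C.nodeValue x j = true := by
  by_cases h : j < C.inputs
  · rw [nodeFormula_input k h, nodeValue_input x ⟨j, h⟩, hx]
    simp [inputFormula, Formula.Holds, Formula.holds_conj]
  · obtain ⟨i, g, rfl, hg⟩ := exists_gate hj h
    rw [nodeFormula_gate k hg, nodeValue_gate hC x hg]
    cases g <;> simp [gateFormula, Formula.Holds, Formula.holds_conj]

/-- Unrolling does not change the truth value, which is that of the output node. -/
theorem holds_unroll (hC : C.WellFormed) {k h : ℕ} (hd : C.depth ≤ h) {x : Fin C.inputs → Bool}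
    {A : ℕ → ℕ → Prop} (hx : ∀ j, x j = true ↔ ∃ i ≤ k, A i (j + 1)) {t : ℕ} (ht : t ≤ h + 1) :
    (C.unroll k t).Holds (fun j => C.nodeValue x j = true) A ↔ C.eval x = true := by
  induction t with
  | zero => rfl
  | succ t ih =>
    rw [← ih (by omega), unroll, Formula.holds_subst]
    exact (bounded_unroll hC k hd (by omega)).holds_congr fun j hj => holds_nodeFormula hC hx hj.1

end Circuit

/-! ### The reduction -/

/-- The formulas that have to have probability zero: variable `0` has another value than `0`, two
variables have a common value, the circuit rejects. -/
def forbidden (C : Circuit) (k h : ℕ) : List Formula :=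
  .neg (.atom 0 0) ::
    (((List.range (k + 1)).flatMap fun i => (List.range i).flatMap fun j =>
      (List.range (C.inputs + 1)).map fun v => .and (.atom i v) (.atom j v)) ++
    [.neg (C.unroll k (h + 1))])

/-- The instance of SAT(prob, base) for a circuit with weight `k` and depth at most `h`. -/
def satOfCircuit (C : Circuit) (k h : ℕ) : SatInstance where
  n := k + 1
  d := C.inputs + 1
  φ := (forbidden C k h).map fun F =>
    ⟨F.toEvent k C.inputs, Formula.falsum.toEvent k C.inputs⟩

theorem bounded_of_mem_forbidden {C : Circuit} (hC : C.WellFormed) {k h : ℕ} (hd : C.depth ≤ h)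
    {F : Formula} (hF : F ∈ forbidden C k h) :
    F.Bounded (k + 1) (C.inputs + 1) fun _ => False := by
  simp only [forbidden, List.mem_cons, List.mem_append, List.mem_flatMap, List.mem_range,
    List.mem_map, List.not_mem_nil, or_false] at hF
  rcases hF with rfl | ⟨i, hi, j, hj, v, hv, rfl⟩ | rfl
  · simp [Formula.Bounded]
  · simp only [Formula.Bounded]
    omega
  · exact Circuit.bounded_unroll_depth hC k hd

theorem encList_eq_flatMap {α : Type} (e : α → List Token) (l : List α) :
    encList e l = l.flatMap (fun a => Token.next :: e a) ++ [Token.last] := by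
  induction l with
  | nil => rfl
  | cons a l ih => simp [encList, ih]

/-- The text of the constructed instance in terms of formulas. -/
theorem encSatInstance_satOfCircuit {C : Circuit} (hC : C.WellFormed) {k h : ℕ}
    (hd : C.depth ≤ h) :
    encSatInstance (satOfCircuit C k h) = encNat (k + 1) ++ (encNat (C.inputs + 1) ++
      ((forbidden C k h).flatMap (fun F => Token.next :: (F.code ++ Formula.falsum.code)) ++
        [Token.last])) := by
  simp only [encSatInstance, satOfCircuit, encList_eq_flatMap, List.flatMap_map]
  congr 3
  refine List.flatMap_congr fun F hF => ?_
  rw [encIneq, Formula.encEvent_toEvent (bounded_of_mem_forbidden hC hd hF),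
    Formula.encEvent_toEvent (Formula.bounded_falsum _ _ _)]

/-- An instance whose inequalities bound probabilities by the probability of an impossible event is
satisfiable if and only if some assignment avoids all the bounded events. -/
theorem satisfiable_iff_exists_assignment {n d : ℕ} {l : List (Event n d)} {ε₀ : Event n d}
    (hε₀ : ∀ s, ¬ ε₀.Holds s) :
    SatInstance.Satisfiable ⟨n, d, l.map fun ε => ⟨ε, ε₀⟩⟩ ↔
      ∃ s : Fin n → Fin d, ∀ ε ∈ l, ¬ ε.Holds s := by
  have hzero : ∀ M : SCM n d, M.prob ε₀ = 0 := fun M => by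
    have : IsEmpty {u : (U : M.Hidden) → M.Val U // ε₀.Holds (M.eval u)} :=
      ⟨fun u => hε₀ _ u.2⟩
    simp [SCM.prob]
  constructor
  · rintro ⟨M, hM⟩
    -- any outcome of positive probability avoids the events of probability zero
    obtain ⟨u, hu⟩ := M.P.support_nonempty
    refine ⟨M.eval u, fun ε hε h => ?_⟩
    have h1 := hM ⟨ε, ε₀⟩ (List.mem_map_of_mem (f := fun ε => BaseIneq.mk ε ε₀) hε)
    have h2 : M.P u ≤ M.prob ε :=
      ENNReal.le_tsum (f := fun u : {u // ε.Holds (M.eval u)} => M.P u.1) ⟨u, h⟩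
    rw [PMF.mem_support_iff] at hu
    refine hu (le_antisymm (h2.trans (h1.trans (hzero M).le)) zero_le)
  · rintro ⟨s, hs⟩
    -- a model without hidden variables, whose observed variables are constant
    refine ⟨⟨(· < ·), inferInstance, Empty, inferInstance, fun _ => Unit, fun _ => inferInstance,
      fun V _ _ => s V, PMF.pure fun _ => ()⟩, fun c hc => ?_⟩
    obtain ⟨ε, hε, rfl⟩ := List.mem_map.1 hc
    refine le_of_eq_of_le ?_ zero_le
    rw [SCM.prob]
    have : IsEmpty {u : (U : Empty) → Unit // ε.Holds (SCM.eval ⟨(· < ·), inferInstance, Empty,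
        inferInstance, fun _ => Unit, fun _ => inferInstance, fun V _ _ => s V,
        PMF.pure fun _ => ()⟩ u)} := by
      refine ⟨fun u => hs ε hε ?_⟩
      convert u.2 using 1
      funext V
      rw [SCM.eval_eq]
    exact tsum_empty

/-- The variables other than variable `0` select `k` inputs, if all values are distinct. -/
theorem card_selected {k N : ℕ} {s : Fin (k + 1) → Fin (N + 1)} (h0 : s 0 = 0)
    (hs : Function.Injective s) {x : Fin N → Bool}
    (hx : ∀ j, x j = true ↔ ∃ i, s i = j.succ) :
    (Finset.univ.filter fun j => x j = true).card = k := by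
  have himg : (Finset.univ.filter fun j => x j = true).map (Fin.succEmb N) =
      (Finset.univ.image s).erase 0 := by
    ext a
    simp only [Finset.mem_map, Finset.mem_filter, Finset.mem_univ, true_and, hx,
      Fin.coe_succEmb, Finset.mem_erase, Finset.mem_image]
    constructor
    · rintro ⟨j, ⟨i, hi⟩, rfl⟩
      exact ⟨Fin.succ_ne_zero j, i, hi⟩
    · rintro ⟨ha, i, rfl⟩
      exact ⟨(s i).pred ha, ⟨i, by simp⟩, by simp⟩
  rw [← Finset.card_map (Fin.succEmb N), himg, Finset.card_erase_of_mem
    (Finset.mem_image.2 ⟨0, Finset.mem_univ _, h0⟩), Finset.card_image_of_injective _ hs]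
  simp

/-- Conversely, every set of `k` inputs is selected by some assignment with distinct values. -/
theorem exists_selection {k N : ℕ} {x : Fin N → Bool}
    (hx : (Finset.univ.filter fun j => x j = true).card = k) :
    ∃ s : Fin (k + 1) → Fin (N + 1), s 0 = 0 ∧ Function.Injective s ∧
      ∀ j, x j = true ↔ ∃ i, s i = j.succ := by
  let e := (Finset.univ.filter fun j => x j = true).equivFinOfCardEq hx
  refine ⟨Fin.cons 0 fun i => (e.symm i).1.succ, rfl, ?_, fun j => ⟨fun h => ?_, ?_⟩⟩
  · rw [Fin.cons_injective_iff]
    refine ⟨?_, fun i j h => ?_⟩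
    · rintro ⟨i, hi⟩
      exact Fin.succ_ne_zero _ hi
    · exact e.symm.injective (Subtype.ext (Fin.succ_injective _ h))
  · exact ⟨(e ⟨j, by simpa using h⟩).succ, by simp⟩
  · rintro ⟨i, hi⟩
    refine Fin.cases (fun h => ?_) (fun i h => ?_) i hi
    · exact absurd h.symm (Fin.succ_ne_zero _)
    · rw [Fin.cons_succ] at h
      rw [← Fin.succ_injective _ h]
      have := (e.symm i).2
      exact (Finset.mem_filter.1 this).2

/-- An assignment avoids the forbidden formulas if and only if variable `0` has the value `0`, all
values are distinct and the circuit accepts the selected inputs. -/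
theorem avoids_forbidden_iff {C : Circuit} (hC : C.WellFormed) {k h : ℕ} (hd : C.depth ≤ h)
    {s : Fin (k + 1) → Fin (C.inputs + 1)} {x : Fin C.inputs → Bool}
    (hx : ∀ j, x j = true ↔ ∃ i, s i = j.succ) :
    (∀ F ∈ forbidden C k h, ¬ (F.toEvent k C.inputs).Holds s) ↔
      s 0 = 0 ∧ Function.Injective s ∧ C.eval x = true := by
  have hx' : ∀ j, x j = true ↔ ∃ i ≤ k, s (Fin.ofNat _ i) = Fin.ofNat _ ((j : ℕ) + 1) := by
    intro j
    have hj : Fin.ofNat (C.inputs + 1) ((j : ℕ) + 1) = j.succ := by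
      ext; simp [Nat.mod_eq_of_lt]
    rw [hx, hj]
    constructor
    · rintro ⟨i, hi⟩
      exact ⟨i, by omega, by simpa using hi⟩
    · rintro ⟨i, -, hi⟩
      exact ⟨_, hi⟩
  have hout := Circuit.holds_unroll (A := fun V v => s (Fin.ofNat _ V) = Fin.ofNat _ v) hC hd hx'
    le_rfl
  have hbd := @bounded_of_mem_forbidden C hC k h hd
  have key : ∀ F ∈ forbidden C k h, ((F.toEvent k C.inputs).Holds s ↔
      F.Holds (fun j => C.nodeValue x j = true) fun V v =>
        s (Fin.ofNat _ V) = Fin.ofNat _ v) :=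
    fun F hF => Formula.holds_toEvent (hbd hF) s _
  rw [forall₂_congr fun F hF => not_congr (key F hF)]
  simp only [forbidden, List.forall_mem_cons, List.forall_mem_append, List.mem_flatMap,
    List.mem_map, List.mem_range, Formula.Holds, hout, List.not_mem_nil, not_not]
  refine and_congr (by simp) (and_congr ⟨fun H i j hij => ?_, fun H => ?_⟩ (by simp))
  · by_contra hne
    wlog hlt : j < i generalizing i j
    · exact this j i hij.symm (Ne.symm hne) (lt_of_le_of_ne (not_lt.1 hlt) hne)
    refine H _ ⟨i, i.2, j, hlt, s i, (s i).2, rfl⟩ ⟨?_, ?_⟩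
    · simp [Formula.Holds]
    · simp [Formula.Holds, hij]
  · rintro F ⟨i, hi, j, hj, v, hv, rfl⟩ ⟨h1, h2⟩
    have := congrArg Fin.val (H (h1.trans h2.symm))
    simp [Nat.mod_eq_of_lt hi, Nat.mod_eq_of_lt (hj.trans hi)] at this
    omega

/-- Correctness of the reduction. -/
theorem satisfiable_satOfCircuit_iff {C : Circuit} (hC : C.WellFormed) {k h : ℕ}
    (hd : C.depth ≤ h) :
    (satOfCircuit C k h).Satisfiable ↔ C.HasWeightedSolution k := by
  have h1 := satisfiable_iff_exists_assignment
    (l := (forbidden C k h).map fun F => F.toEvent k C.inputs)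
    (ε₀ := Formula.falsum.toEvent k C.inputs) fun s => by
      rw [Formula.holds_toEvent (Formula.bounded_falsum _ _ _) s fun _ => True]
      exact Formula.not_holds_falsum _ _
  rw [List.map_map] at h1
  refine Iff.trans h1 ?_
  simp only [List.forall_mem_map]
  constructor
  · rintro ⟨s, hs⟩
    classical
    let x : Fin C.inputs → Bool := fun j => decide (∃ i, s i = j.succ)
    have hx : ∀ j, x j = true ↔ ∃ i, s i = j.succ := fun j => by simp [x]
    obtain ⟨h0, hinj, he⟩ := (avoids_forbidden_iff hC hd hx).1 hs
    exact ⟨x, card_selected h0 hinj hx, he⟩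
  · rintro ⟨x, hcard, he⟩
    obtain ⟨s, h0, hinj, hx⟩ := exists_selection hcard
    exact ⟨s, (avoids_forbidden_iff hC hd hx).2 ⟨h0, hinj, he⟩⟩

/-! ### Treewidth -/

/-- The treewidth is at most the number of vertices, because bags are sets of vertices. -/
theorem treewidth_le {n : ℕ} (G : SimpleGraph (Fin n)) : treewidth G ≤ n := by
  rcases Set.eq_empty_or_nonempty {w | ∃ X : NiceTreeDecomposition G, X.width = w} with h | ⟨w, hw⟩
  -- this case does not occur, but it is simpler to bound the infimum than to exhibit a decomposition
  · rw [treewidth, h, Nat.sInf_empty]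
    exact Nat.zero_le _
  · refine (Nat.sInf_le hw).trans ?_
    obtain ⟨X, rfl⟩ := hw
    refine (Nat.sub_le _ _).trans (Finset.sup_le fun N _ => ?_)
    simpa using (X.bag N).card_le_univ

end CausalSat

namespace CausalSat

open Function

namespace StackProg

/-! ### Building blocks of stack programs -/

section Blocks

variable {κ α : Type} [DecidableEq κ]

/-- The program turns the stack contents `σ` into `σ'` with at most `T` elementary operations. -/
def Within (p : StackProg κ α) (σ σ' : κ → List α) (T : ℕ) : Prop := ∃ t ≤ T, Runs p σ σ' t

variable {p q : StackProg κ α} {σ σ' σ₁ σ₂ σ₃ : κ → List α} {k k' : κ} {S : Option α → Bool}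
  {s t T : ℕ}

theorem Within.mono (h : Within p σ σ' s) (hst : s ≤ t) : Within p σ σ' t :=
  let ⟨u, hu, hr⟩ := h
  ⟨u, hu.trans hst, hr⟩

theorem Within.congr (h : Within p σ σ₁ s) (e : σ₁ = σ') (hst : s ≤ t) : Within p σ σ' t :=
  e ▸ h.mono hst

theorem Within.push (k : κ) (a : α) (σ : κ → List α) :
    Within (push k a) σ (update σ k (a :: σ k)) 1 := ⟨1, le_rfl, .push k a σ⟩

theorem Within.mv {a : α} {l : List α} (ks : List κ) (h : σ k = a :: l) :
    Within (mv k ks) σ (pushAll a ks (update σ k l)) 1 := ⟨1, le_rfl, .mv h⟩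

theorem Within.seq (h₁ : Within p σ₁ σ₂ s) (h₂ : Within q σ₂ σ₃ t) :
    Within (seq p q) σ₁ σ₃ (s + t) :=
  let ⟨u, hu, hr⟩ := h₁
  let ⟨v, hv, hs⟩ := h₂
  ⟨u + v, add_le_add hu hv, hr.seq hs⟩

theorem Within.ite_pos (hS : S (σ k).head? = true) (h : Within p σ σ' t) :
    Within (ite k S p q) σ σ' (t + 1) :=
  let ⟨u, hu, hr⟩ := h
  ⟨u + 1, by omega, .ite_pos hS hr⟩

theorem Within.ite_neg (hS : S (σ k).head? = false) (h : Within q σ σ' t) :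
    Within (ite k S p q) σ σ' (t + 1) :=
  let ⟨u, hu, hr⟩ := h
  ⟨u + 1, by omega, .ite_neg hS hr⟩

theorem Within.loop_done (hS : S (σ k).head? = false) : Within (loop k S p) σ σ 1 :=
  ⟨1, le_rfl, .loop_done hS⟩

theorem Within.loop_step (hS : S (σ₁ k).head? = true) (h₁ : Within p σ₁ σ₂ s)
    (h₂ : Within (loop k S p) σ₂ σ₃ t) : Within (loop k S p) σ₁ σ₃ (s + t + 1) :=
  let ⟨u, hu, hr⟩ := h₁
  let ⟨v, hv, hs⟩ := h₂
  ⟨u + v + 1, by omega, .loop_step hS hr hs⟩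

/-- A loop that is run exactly `m` times. -/
theorem Within.loop_iterate (ρ : ℕ → κ → List α) (m : ℕ)
    (hpos : ∀ i < m, S (ρ i k).head? = true) (hneg : S (ρ m k).head? = false)
    (h : ∀ i < m, Within p (ρ i) (ρ (i + 1)) T) :
    Within (loop k S p) (ρ 0) (ρ m) (m * (T + 1) + 1) := by
  induction m generalizing ρ with
  | zero => exact (Within.loop_done hneg).mono (by omega)
  | succ m ih =>
    refine (Within.loop_step (hpos 0 (by omega)) (h 0 (by omega))
      (ih (fun i => ρ (i + 1)) (fun i hi => hpos _ (by omega)) hneg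
        (fun i hi => h _ (by omega)))).mono ?_
    rw [Nat.succ_mul]
    omega

/-- Number of entries that an elementary operation of the program pushes on a stack, at most. -/
def width : StackProg κ α → ℕ
  | .push _ _ => 1
  | .mv _ ks => ks.length
  | .seq p q => max (width p) (width q)
  | .ite _ _ p q => max (width p) (width q)
  | .loop _ _ p => width p

theorem length_pushAll_le (a : α) (ks : List κ) (σ : κ → List α) (k : κ) :
    (pushAll a ks σ k).length ≤ (σ k).length + ks.length := by
  induction ks generalizing σ with
  | nil => simp [pushAll]
  | cons k' ks ih =>
    refine (ih _).trans ?_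
    by_cases h : k = k'
    · subst h; simp; omega
    · simp [h]

/-- Running time bounds the growth of stacks. -/
theorem Runs.length_le (h : Runs p σ σ' t) (k : κ) :
    (σ' k).length ≤ (σ k).length + p.width * t := by
  induction h with
  | push k' a σ =>
    by_cases h : k = k'
    · subst h; simp [width]
    · simp [h]
  | @mv k' ks σ a l h =>
    refine (length_pushAll_le _ _ _ _).trans ?_
    by_cases hk : k = k'
    · subst hk; simp [width, h]
    · simp [hk, width]
  | @seq p q σ₁ σ₂ σ₃ s t h₁ h₂ ih₁ ih₂ =>
    have e1 : p.width * s ≤ (p.seq q).width * s := Nat.mul_le_mul_right _ (le_max_left _ _)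
    have e2 : q.width * t ≤ (p.seq q).width * t := Nat.mul_le_mul_right _ (le_max_right _ _)
    rw [mul_add]
    omega
  | @ite_pos k' S p q σ σ' t hS h ih =>
    have e1 : p.width * t ≤ (p.ite k' S q).width * t := Nat.mul_le_mul_right _ (le_max_left _ _)
    rw [mul_add]
    omega
  | @ite_neg k' S p q σ σ' t hS h ih =>
    have e1 : q.width * t ≤ (p.ite k' S q).width * t := Nat.mul_le_mul_right _ (le_max_right _ _)
    rw [mul_add]
    omega
  | loop_done => omega
  | loop_step hS h₁ h₂ ih₁ ih₂ =>
    simp only [width] at *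
    rw [mul_add, mul_add]
    omega

theorem Within.length_le (h : Within p σ σ' T) (k : κ) :
    (σ' k).length ≤ (σ k).length + p.width * T := by
  obtain ⟨t, ht, hr⟩ := h
  exact (hr.length_le k).trans (by gcongr)

/-- Move entries from `k` to `k'` as long as the test succeeds. -/
def moveWhile (k : κ) (S : Option α → Bool) (k' : κ) : StackProg κ α := loop k S (mv k [k'])

theorem within_moveWhile {k k' : κ} (hk : k ≠ k') {l m : List α} (h : σ k = l ++ m)
    (hl : ∀ a ∈ l, S (some a) = true) (hm : S m.head? = false) :
    Within (moveWhile k S k') σ (update (update σ k m) k' (l.reverse ++ σ k'))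
      (2 * l.length + 1) := by
  induction l generalizing σ with
  | nil =>
    have e : update (update σ k m) k' (([] : List α).reverse ++ σ k') = σ := by
      rw [List.nil_append] at h
      subst h
      simp
    rw [e]
    exact (Within.loop_done (by rw [h]; exact hm)).mono (by simp)
  | cons a l ih =>
    have h1 : Within (mv k [k']) σ (update (update σ k (l ++ m)) k' (a :: σ k')) 1 := by
      have := Within.mv (σ := σ) (k := k) (a := a) (l := l ++ m) [k'] h
      simpa [pushAll, hk.symm] using this
    have h2 := ih (σ := update (update σ k (l ++ m)) k' (a :: σ k')) (by simp [hk])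
      (fun b hb => hl b (by simp [hb]))
    rw [update_comm hk.symm, update_idem, update_idem, update_self] at h2
    refine (Within.loop_step ?_ h1 h2).congr ?_ ?_
    · rw [h]; exact hl a (by simp)
    · simp
    · simp only [List.length_cons]; omega

/-- Move all entries from `k` to `k'`. -/
def moveAll (k k' : κ) : StackProg κ α := moveWhile k Option.isSome k'

theorem within_moveAll {k k' : κ} (hk : k ≠ k') (σ : κ → List α) :
    Within (moveAll k k') σ (update (update σ k []) k' ((σ k).reverse ++ σ k'))
      (2 * (σ k).length + 1) :=
  within_moveWhile hk (by simp) (by simp) rfl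

/-- Empty a stack. -/
def clear (k : κ) : StackProg κ α := loop k Option.isSome (mv k [])

theorem within_clear (k : κ) (σ : κ → List α) :
    Within (clear k) σ (update σ k []) (2 * (σ k).length + 1) := by
  generalize hl : σ k = l
  induction l generalizing σ with
  | nil =>
    have e : update σ k [] = σ := by rw [← hl]; simp
    rw [e]
    exact (Within.loop_done (by rw [hl]; rfl)).mono (by simp)
  | cons a l ih =>
    have h2 := ih (update σ k l) (by simp)
    rw [update_idem] at h2
    refine (Within.loop_step (by rw [hl]; rfl) (Within.mv [] hl) h2).mono ?_
    simp only [List.length_cons]; omega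

/-- Move entries from `k` to `tmp` as long as the test succeeds, copying them to `k'` as well. -/
def copyWhile (k : κ) (S : Option α → Bool) (tmp k' : κ) : StackProg κ α :=
  loop k S (mv k [tmp, k'])

theorem within_copyWhile {k tmp k' : κ} (h₁ : k ≠ tmp) (h₂ : k ≠ k') (h₃ : tmp ≠ k') {l m : List α}
    (h : σ k = l ++ m) (hl : ∀ a ∈ l, S (some a) = true) (hm : S m.head? = false) :
    Within (copyWhile k S tmp k') σ (update (update (update σ k m) tmp (l.reverse ++ σ tmp)) k'
      (l.reverse ++ σ k')) (2 * l.length + 1) := by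
  induction l generalizing σ with
  | nil =>
    have e : update (update (update σ k m) tmp (([] : List α).reverse ++ σ tmp)) k'
        (([] : List α).reverse ++ σ k') = σ := by
      rw [List.nil_append] at h
      subst h
      simp
    rw [e]
    exact (Within.loop_done (by rw [h]; exact hm)).mono (by simp)
  | cons a l ih =>
    set σ₁ := update (update (update σ k (l ++ m)) tmp (a :: σ tmp)) k' (a :: σ k') with hσ₁
    have e1 : σ₁ k = l ++ m := by simp [hσ₁, h₁, h₂]
    have h1 : Within (mv k [tmp, k']) σ σ₁ 1 := by
      have := Within.mv (σ := σ) (k := k) (a := a) (l := l ++ m) [tmp, k'] h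
      simpa [pushAll, h₁.symm, h₂.symm, h₃.symm] using this
    have h2 := ih e1 (fun b hb => hl b (by simp [hb]))
    refine (Within.loop_step ?_ h1 h2).congr ?_ ?_
    · rw [h]; exact hl a (by simp)
    · funext j
      rcases eq_or_ne j k' with rfl | hj'
      · simp [hσ₁]
      · rcases eq_or_ne j tmp with rfl | hj
        · simp [hσ₁, h₃]
        · rcases eq_or_ne j k with rfl | hjk
          · simp [hσ₁, hj, hj']
          · simp [hσ₁, hj, hj', hjk]
    · simp only [List.length_cons]; omega

/-- Copy the stack `k` onto `r`, so that `r` shows it in reverse; `tmp` has to be empty. -/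
def copyAll (k tmp r : κ) : StackProg κ α :=
  seq (copyWhile k Option.isSome tmp r) (moveAll tmp k)

theorem within_copyAll {k tmp r : κ} (h₁ : k ≠ tmp) (h₂ : k ≠ r) (h₃ : tmp ≠ r)
    (h : σ tmp = []) :
    Within (copyAll k tmp r) σ (update σ r ((σ k).reverse ++ σ r)) (4 * (σ k).length + 2) := by
  have e1 := within_copyWhile (σ := σ) (S := Option.isSome) h₁ h₂ h₃ (l := σ k) (m := [])
    (by simp) (by simp) rfl
  have e2 := within_moveAll (k := tmp) (k' := k) h₁.symm (update (update (update σ k []) tmp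
    ((σ k).reverse ++ σ tmp)) r ((σ k).reverse ++ σ r))
  refine (e1.seq e2).congr ?_ (by simp [h₃, h]; omega)
  · funext j
    rcases eq_or_ne j k with rfl | hjk
    · simp [h, h₁, h₂, h₃]
    · rcases eq_or_ne j tmp with rfl | hj
      · simp [h, h₃, hjk]
      · rcases eq_or_ne j r with rfl | hjr
        · simp [hjk, hj]
        · simp [hjk, hj, hjr]

/-- What a template of entries and stack names stands for. -/
def expand (σ : κ → List α) (is : List (α ⊕ κ)) : List α :=
  is.flatMap fun i => i.elim (fun a => [a]) σ

/-- Write the expansion of a template in reverse onto the stack `r`. The auxiliary stack `tmp` has to be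
empty, so that clearing it in the end changes nothing. -/
def emit (tmp r : κ) : List (α ⊕ κ) → StackProg κ α
  | [] => clear tmp
  | Sum.inl a :: is => seq (push r a) (emit tmp r is)
  | Sum.inr k :: is => seq (copyAll k tmp r) (emit tmp r is)

theorem within_emit {tmp r : κ} (hr : tmp ≠ r) {is : List (α ⊕ κ)} {B : ℕ}
    (h : ∀ k, Sum.inr k ∈ is → k ≠ tmp ∧ k ≠ r ∧ (σ k).length ≤ B) (ht : σ tmp = []) :
    Within (emit tmp r is) σ (update σ r ((expand σ is).reverse ++ σ r))
      (is.length * (4 * B + 2) + 1) := by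
  induction is generalizing σ with
  | nil =>
    have h1 := within_clear tmp σ
    rw [ht] at h1
    have e : update σ tmp [] = σ := by rw [← ht]; simp
    rw [e] at h1
    simpa [expand, emit] using h1
  | cons i is ih =>
    have hexp : ∀ l, expand (update σ r l) is = expand σ is := fun l => by
      refine List.flatMap_congr fun i hi => ?_
      cases i with
      | inl a => rfl
      | inr k => simp [(h k (by simp [hi])).2.1]
    have step : ∀ l, Within (emit tmp r is) (update σ r l)
        (update σ r ((expand σ is).reverse ++ l)) (is.length * (4 * B + 2) + 1) := fun l => by
      have := ih (σ := update σ r l) (fun k hk => by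
        have := h k (by simp [hk])
        simpa [this.2.1] using this) (by simp [hr, ht])
      simpa [hexp] using this
    cases i with
    | inl a =>
      refine ((Within.push r a σ).seq (step _)).congr ?_ ?_
      · simp [expand]
      · rw [List.length_cons, add_mul, one_mul]; omega
    | inr k =>
      obtain ⟨h1, h2, h3⟩ := h k (by simp)
      refine ((within_copyAll h1 h2 hr ht).seq (step _)).congr ?_ ?_
      · simp [expand]
      · rw [List.length_cons, add_mul, one_mul]; omega

/-- Run the program once for each entry of the stack `k`; in the meantime the entries that have been
dealt with are on the stack `k'`. -/
def forEach (k k' : κ) (p : StackProg κ α) : StackProg κ α :=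
  seq (loop k Option.isSome (seq p (mv k [k']))) (moveAll k' k)

/-- Concatenate the outputs of the rounds of a counting loop on the stack `r`. -/
theorem within_forEach {k k' r : κ} (h₁ : k ≠ k') (h₂ : k ≠ r) (h₃ : k' ≠ r) {m : ℕ} {a : α}
    (hk : σ k = List.replicate m a) (hk' : σ k' = []) {f : ℕ → List α}
    (h : ∀ c < m, ∀ l, Within p
      (update (update (update σ k (List.replicate (m - c) a)) k' (List.replicate c a)) r l)
      (update (update (update σ k (List.replicate (m - c) a)) k' (List.replicate c a)) r
        ((f c).reverse ++ l)) T) :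
    Within (forEach k k' p) σ (update σ r (((List.range m).flatMap f).reverse ++ σ r))
      (m * (T + 4) + 2) := by
  let ρ : ℕ → κ → List α := fun c => update (update (update σ k (List.replicate (m - c) a)) k'
    (List.replicate c a)) r (((List.range c).flatMap f).reverse ++ σ r)
  have h0 : ρ 0 = σ := by
    have e1 : update σ k (List.replicate m a) = σ := by rw [← hk]; simp
    have e2 : update σ k' [] = σ := by rw [← hk']; simp
    simp [ρ, e1, e2]
  have hloop : Within (loop k Option.isSome (seq p (mv k [k']))) (ρ 0) (ρ m)
      (m * (T + 1 + 1) + 1) := by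
    refine Within.loop_iterate ρ m (fun c hc => ?_) ?_ fun c hc => (h c hc _).seq ?_
    · obtain ⟨d, hd⟩ : ∃ d, m - c = d + 1 := ⟨m - c - 1, by omega⟩
      simp [ρ, h₁, h₂, hd, List.replicate_succ]
    · simp [ρ, h₁, h₂]
    · have hd : m - c = m - (c + 1) + 1 := by omega
      have := Within.mv (σ := update (update (update σ k (List.replicate (m - c) a)) k'
        (List.replicate c a)) r ((f c).reverse ++ (((List.range c).flatMap f).reverse ++ σ r)))
        (k := k) (a := a) (l := List.replicate (m - (c + 1)) a) [k']
        (by simp [h₁, h₂, hd, List.replicate_succ])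
      convert this using 1
      funext j
      rcases eq_or_ne j k' with rfl | hj'
      · simp [ρ, pushAll, h₁.symm, h₃, List.replicate_succ]
      · rcases eq_or_ne j k with rfl | hj
        · simp [ρ, pushAll, h₁, h₂]
        · rcases eq_or_ne j r with rfl | hjr
          · simp [ρ, pushAll, hj, hj', List.range_succ]
          · simp [ρ, pushAll, hj, hj', hjr]
  rw [h0] at hloop
  refine (hloop.seq (within_moveAll h₁.symm (ρ m))).congr ?_ ?_
  rotate_left
  · have : (ρ m k').length = m := by simp [ρ, h₃]
    rw [this]
    nlinarith
  · funext j
    rcases eq_or_ne j k' with rfl | hj'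
    · simp [ρ, h₁.symm, h₃, hk']
    · rcases eq_or_ne j k with rfl | hj
      · simp [ρ, h₁, h₂, h₃, hk]
      · rcases eq_or_ne j r with rfl | hjr
        · simp [ρ, hj, hj']
        · simp [ρ, hj, hj', hjr]

end Blocks

end StackProg

end CausalSat

namespace CausalSat

open Function StackProg

/-! ### The stacks of the reduction -/

instance : Inhabited Token := ⟨Token.bit⟩

/-- The stacks used by the reduction. -/
inductive Reg where
  | work | source | weight | inputs | row | col | val | acc | tmp | table | result
  deriving DecidableEq

instance : Fintype Reg where
  elems := {Reg.work, Reg.source, Reg.weight, Reg.inputs, Reg.row, Reg.col, Reg.val, Reg.acc,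
    Reg.tmp, Reg.table, Reg.result}
  complete := by intro x; cases x <;> decide

/-- The contents of the stacks used by the reduction: `work` holds the input at first, then the
formula that is being unrolled, and the output in the end; `source` holds the input that has not been
read yet; `weight` and `inputs` hold the numbers of variables and of values in unary, `row`, `col`
and `val` count the rounds of loops; `acc` and `result` collect text in reverse; `table` holds the
formulas of the nodes, each one followed by the token `or`. -/
structure Regs where
  work : List Token := []
  source : List Token := []
  weight : List Token := []
  inputs : List Token := []
  row : List Token := []
  col : List Token := []
  val : List Token := []
  acc : List Token := []
  tmp : List Token := []
  table : List Token := []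
  result : List Token := []

namespace Regs

/-- Contents of one stack. -/
def stk (ρ : Regs) : Reg → List Token
  | .work => ρ.work
  | .source => ρ.source
  | .weight => ρ.weight
  | .inputs => ρ.inputs
  | .row => ρ.row
  | .col => ρ.col
  | .val => ρ.val
  | .acc => ρ.acc
  | .tmp => ρ.tmp
  | .table => ρ.table
  | .result => ρ.result

/-- Replace the contents of one stack. -/
def set (ρ : Regs) (c : Reg) (l : List Token) : Regs :=
  match c with
  | .work => { ρ with work := l }
  | .source => { ρ with source := l }
  | .weight => { ρ with weight := l }
  | .inputs => { ρ with inputs := l }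
  | .row => { ρ with row := l }
  | .col => { ρ with col := l }
  | .val => { ρ with val := l }
  | .acc => { ρ with acc := l }
  | .tmp => { ρ with tmp := l }
  | .table => { ρ with table := l }
  | .result => { ρ with result := l }

theorem update_stk (ρ : Regs) (c : Reg) (l : List Token) : update ρ.stk c l = (ρ.set c l).stk := by
  funext c'
  by_cases h : c' = c
  · subst h
    cases c' <;> simp [set, stk]
  · rw [update_of_ne h]
    cases c <;> cases c' <;> first | exact absurd rfl h | rfl

end Regs

open Regs

/-- The unary code of a number without the separator. -/
abbrev bits (m : ℕ) : List Token := List.replicate m Token.bit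

/-- Test whether the top entry is the token `t`. -/
def isTok (t : Token) : Option Token → Bool := fun o => decide (o = some t)

/-- Move the code of a number from `c` to `c'`. -/
def moveNum (c c' : Reg) : StackProg Reg Token := seq (moveWhile c (isTok .bit) c') (mv c [c'])

theorem reverse_encNat (m : ℕ) : (encNat m).reverse = Token.sep :: bits m := by
  simp [encNat]

theorem length_encNat (m : ℕ) : (encNat m).length = m + 1 := by simp [encNat]

theorem within_moveNum {c c' : Reg} (hc : c ≠ c') {σ : Reg → List Token} {m : ℕ} {l : List Token}
    (h : σ c = encNat m ++ l) :
    Within (moveNum c c') σ (update (update σ c l) c' ((encNat m).reverse ++ σ c')) (2 * m + 2) := by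
  have h1 := within_moveWhile (S := isTok .bit) hc (σ := σ) (l := bits m) (m := Token.sep :: l)
    (by simp [h, encNat]) (fun a ha => by rw [List.eq_of_mem_replicate ha]; rfl) rfl
  have h2 := Within.mv (σ := update (update σ c (Token.sep :: l)) c' ((bits m).reverse ++ σ c'))
    (k := c) (a := .sep) (l := l) [c'] (by simp [hc])
  refine (h1.seq h2).congr ?_ (by simp)
  funext d
  rcases eq_or_ne d c' with rfl | hd'
  · simp [pushAll, reverse_encNat, hc.symm]
  · rcases eq_or_ne d c with rfl | hd
    · simp [pushAll, hd']
    · simp [pushAll, hd, hd']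

/-! ### Reading the input -/

/-- Read the weight, the number of inputs and the output node. -/
def parse : StackProg Reg Token :=
  seq (moveAll .work .source) <|
  seq (push .weight .bit) <| seq (moveNum .source .weight) <| seq (mv .weight []) <|
  seq (push .inputs .bit) <| seq (moveNum .source .inputs) <| seq (mv .inputs []) <|
  seq (push .acc .next) <| seq (moveNum .source .acc) (moveAll .acc .work)

theorem replicate_append_singleton (m : ℕ) (t : Token) :
    List.replicate m t ++ [t] = List.replicate (m + 1) t :=
  (List.replicate_succ' (n := m)).symm

theorem within_parse (k N o : ℕ) (l : List Token) {B : ℕ}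
    (hB : (encNat k ++ (encNat N ++ (encNat o ++ l))).length < B) :
    Within parse (stk { work := (encNat k ++ (encNat N ++ (encNat o ++ l))).reverse })
      (stk { work := Token.next :: encNat o, source := l, weight := bits (k + 1),
             inputs := bits (N + 1) }) (30 * B) := by
  have h1 := within_moveAll (k := Reg.work) (k' := .source) (by decide)
    (stk { work := (encNat k ++ (encNat N ++ (encNat o ++ l))).reverse })
  simp only [update_stk, Regs.set, stk, List.reverse_reverse, List.append_nil,
    List.length_reverse] at h1
  have h2 := Within.push Reg.weight Token.bit
    (stk { source := encNat k ++ (encNat N ++ (encNat o ++ l)) })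
  have h3 := within_moveNum (c := .source) (c' := .weight) (by decide)
    (σ := stk { source := encNat k ++ (encNat N ++ (encNat o ++ l)), weight := [.bit] }) rfl
  have h4 := Within.mv (k := Reg.weight) (l := bits (k + 1)) [] (σ := stk {
    source := encNat N ++ (encNat o ++ l), weight := .sep :: bits (k + 1) }) rfl
  have h5 := Within.push Reg.inputs Token.bit
    (stk { source := encNat N ++ (encNat o ++ l), weight := bits (k + 1) })
  have h6 := within_moveNum (c := .source) (c' := .inputs) (by decide)
    (σ := stk { source := encNat N ++ (encNat o ++ l), weight := bits (k + 1),
                inputs := [.bit] }) rfl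
  have h7 := Within.mv (k := Reg.inputs) (l := bits (N + 1)) [] (σ := stk {
    source := encNat o ++ l, weight := bits (k + 1), inputs := .sep :: bits (N + 1) }) rfl
  have h8 := Within.push Reg.acc Token.next (stk {
    source := encNat o ++ l, weight := bits (k + 1), inputs := bits (N + 1) })
  have h9 := within_moveNum (c := .source) (c' := .acc) (by decide) (σ := stk {
    source := encNat o ++ l, weight := bits (k + 1), inputs := bits (N + 1), acc := [.next] }) rfl
  have h10 := within_moveAll (k := Reg.acc) (k' := .work) (by decide) (stk {
    source := l, weight := bits (k + 1), inputs := bits (N + 1),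
    acc := (encNat o).reverse ++ [.next] })
  simp only [pushAll, update_stk, Regs.set, stk, List.append_nil,
    reverse_encNat, List.cons_append, replicate_append_singleton, List.reverse_append,
    List.reverse_cons, List.reverse_nil, List.nil_append, List.reverse_replicate] at h2 h3 h4 h5 h6 h7 h8 h9 h10
  refine (h1.seq <| h2.seq <| h3.seq <| h4.seq <| h5.seq <| h6.seq <| h7.seq <| h8.seq <|
    h9.seq h10).congr ?_ ?_
  · simp [encNat]
  · simp only [List.length_append, length_encNat] at hB
    simp [length_encNat]
    omega

/-! ### Writing the constraints on the variables -/

theorem within_emit_regs {r : Reg} (hr : Reg.tmp ≠ r) (ρ : Regs) {is : List (Token ⊕ Reg)} {B : ℕ}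
    (h : ∀ c, Sum.inr c ∈ is → c ≠ .tmp ∧ c ≠ r ∧ (ρ.stk c).length ≤ B) (ht : ρ.tmp = []) :
    Within (emit .tmp r is) ρ.stk (ρ.set r ((expand ρ.stk is).reverse ++ ρ.stk r)).stk
      (is.length * (4 * B + 2) + 1) := by
  rw [← update_stk]
  exact within_emit hr h ht

/-- The numbers of variables and of values, and the constraint that variable `0` has the value
`0`. -/
def writeHeader : StackProg Reg Token :=
  emit .tmp .result ([.inr .weight, .inl .sep, .inr .inputs, .inl .sep] ++
    (Token.next :: ((Formula.neg (.atom 0 0)).code ++ Formula.falsum.code)).map .inl)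

theorem within_writeHeader {k N B : ℕ} (hk : k ≤ B) (hN : N ≤ B) {w s : List Token} :
    Within writeHeader (stk { work := w, source := s, weight := bits k, inputs := bits N })
      (stk { work := w, source := s, weight := bits k, inputs := bits N,
             result := (encNat k ++ encNat N ++ Token.next :: ((Formula.neg (.atom 0 0)).code ++
              Formula.falsum.code)).reverse }) (100 * (B + 1)) := by
  refine (within_emit_regs (by decide) _ (B := B) ?_ rfl).congr ?_ ?_
  · intro c hc
    simp only [List.mem_append, List.mem_cons, List.mem_map, reduceCtorEq, Sum.inr.injEq,
      and_false, exists_false, or_false, List.not_mem_nil, false_or] at hc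
    rcases hc with rfl | rfl <;> simp [stk, hk, hN]
  · simp [expand, Regs.set, stk, encNat, Formula.code, Formula.falsum]
  · simp [Formula.code, Formula.falsum, encNat]
    omega

/-- One constraint that two variables do not have the same value. -/
def writePair : StackProg Reg Token :=
  emit .tmp .result ([.inl .next, .inl .and, .inl .atom, .inr .row, .inr .col, .inl .sep, .inr .val,
    .inl .sep, .inl .atom, .inr .col, .inl .sep, .inr .val, .inl .sep] ++
    Formula.falsum.code.map .inl)

theorem within_writePair {B k N i j v : ℕ} (hi : i ≤ B) (hj : j ≤ B) (hv : v ≤ B)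
    {w s r : List Token} :
    Within writePair (stk {
        work := w, source := s, weight := bits k, inputs := bits N,
        row := bits i, col := bits j, val := bits v, result := r })
      (stk {
        work := w, source := s, weight := bits k, inputs := bits N,
        row := bits i, col := bits j, val := bits v,
        result := (Token.next :: ((Formula.and (.atom (i + j) v) (.atom j v)).code ++
              Formula.falsum.code)).reverse ++ r }) (100 * (B + 1)) := by
  refine (within_emit_regs (by decide) _ (B := B) ?_ rfl).congr ?_ ?_
  · intro c hc
    simp only [List.mem_append, List.mem_cons, List.mem_map, reduceCtorEq, Sum.inr.injEq,
      and_false, exists_false, or_false, List.not_mem_nil, false_or] at hc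
    rcases hc with rfl | rfl | rfl | rfl | rfl <;> simp [stk, hi, hj, hv]
  · simp [expand, Regs.set, stk, encNat, Formula.code, Formula.falsum,
      ← List.replicate_append_replicate]
  · simp [Formula.code, Formula.falsum, encNat]
    omega

/-- The constraints that no two variables have the same value. -/
def writePairs : StackProg Reg Token :=
  forEach .weight .row (forEach .row .col (forEach .inputs .val writePair))

theorem within_writePairs {B k N : ℕ} (hk : k ≤ B) (hN : N ≤ B) {w s r : List Token} :
    Within writePairs
      (stk { work := w, source := s, weight := bits k, inputs := bits N, result := r })
      (stk {
        work := w, source := s, weight := bits k, inputs := bits N,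
        result := ((List.range k).flatMap fun i => (List.range i).flatMap fun j =>
          (List.range N).flatMap fun v =>
            Token.next :: ((Formula.and (.atom i v) (.atom j v)).code ++
              Formula.falsum.code)).reverse ++ r })
      (B * (B * (B * (100 * (B + 1) + 4) + 2 + 4) + 2 + 4) + 2) := by
  have h1 := within_forEach (p := forEach .row .col (forEach .inputs .val writePair))
    (k := Reg.weight) (k' := .row) (r := .result) (by decide) (by decide) (by decide) (m := k)
    (a := Token.bit)
    (σ := stk { work := w, source := s, weight := bits k, inputs := bits N, result := r })
    rfl rfl (f := fun i => (List.range i).flatMap fun j =>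
          (List.range N).flatMap fun v =>
            Token.next :: ((Formula.and (.atom i v) (.atom j v)).code ++ Formula.falsum.code))
    (T := B * (B * (100 * (B + 1) + 4) + 2 + 4) + 2) ?_
  · simp only [update_stk, Regs.set] at h1
    exact h1.mono (by gcongr)
  intro i hi l
  simp only [update_stk, Regs.set]
  have h2 := within_forEach (p := forEach .inputs .val writePair)
    (k := Reg.row) (k' := .col) (r := .result) (by decide) (by decide) (by decide) (m := i)
    (a := Token.bit) (σ := stk {
      work := w, source := s, weight := bits (k - i),
      inputs := bits N, row := bits i, result := l })
    rfl rfl (f := fun j => (List.range N).flatMap fun v =>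
            Token.next :: ((Formula.and (.atom i v) (.atom j v)).code ++ Formula.falsum.code))
    (T := B * (100 * (B + 1) + 4) + 2) ?_
  · simp only [update_stk, Regs.set] at h2
    exact h2.mono (by gcongr; omega)
  intro j hj l
  simp only [update_stk, Regs.set]
  have h3 := within_forEach (p := writePair)
    (k := Reg.inputs) (k' := .val) (r := .result) (by decide) (by decide) (by decide) (m := N)
    (a := Token.bit) (σ := stk {
      work := w, source := s, weight := bits (k - i),
      inputs := bits N, row := bits (i - j), col := bits j, result := l })
    rfl rfl (f := fun v =>
            Token.next :: ((Formula.and (.atom i v) (.atom j v)).code ++ Formula.falsum.code))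
    (T := 100 * (B + 1)) ?_
  · simp only [update_stk, Regs.set] at h3
    exact h3.mono (by gcongr)
  intro v hv l
  simp only [update_stk, Regs.set]
  have h4 := within_writePair (B := B) (k := k - i) (N := N - v) (i := i - j) (j := j) (v := v)
    (w := w) (s := s) (r := l) (by omega) (by omega) (by omega)
  rwa [show i - j + j = i by omega] at h4

end CausalSat

namespace CausalSat

open Function StackProg

open Regs

/-! ### Writing the table of node formulas -/

/-- The text of a table: every formula is followed by the token `or`, which does not occur in
formulas. -/
def tableCode (l : List Formula) : List Token := l.flatMap fun F => F.code ++ [Token.or]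

/-- The formulas of the inputs. -/
def writeInputs : StackProg Reg Token :=
  forEach .inputs .val <| seq (push .acc .neg) <|
    seq (forEach .weight .row (emit .tmp .acc [.inl .and, .inl .neg, .inl .atom, .inr .row, .inl .sep,
      .inl .bit, .inr .val, .inl .sep]))
    (emit .tmp .acc ((Formula.verum.code ++ [Token.or]).map .inl))

theorem within_writeInputs {B k N : ℕ} (hk : k + 1 ≤ B) (hN : N ≤ B) {w s r : List Token} :
    Within writeInputs
      (stk { work := w, source := s, weight := bits (k + 1), inputs := bits N, result := r })
      (stk {
        work := w, source := s, weight := bits (k + 1), inputs := bits N,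
        acc := (tableCode ((List.range N).map (Circuit.inputFormula k))).reverse, result := r })
      (B * (1 + (B * (100 * (B + 1) + 4) + 2 + 100) + 4) + 2) := by
  have h1 := within_forEach (k := Reg.inputs) (k' := .val) (r := .acc) (by decide) (by decide)
    (by decide) (m := N) (a := Token.bit)
    (p := seq (push .acc .neg) <|
      seq (forEach .weight .row (emit .tmp .acc [.inl .and, .inl .neg, .inl .atom, .inr .row,
        .inl .sep, .inl .bit, .inr .val, .inl .sep]))
      (emit .tmp .acc ((Formula.verum.code ++ [Token.or]).map .inl)))
    (σ := stk {
      work := w, source := s, weight := bits (k + 1), inputs := bits N, result := r })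
    rfl rfl (f := fun j => (Circuit.inputFormula k j).code ++ [Token.or])
    (T := 1 + (B * (100 * (B + 1) + 4) + 2 + 100)) ?_
  · simp only [update_stk, Regs.set, stk, List.append_nil] at h1
    refine h1.congr ?_ (by gcongr)
    rw [tableCode, List.flatMap_map]
  intro j hj l
  simp only [update_stk, Regs.set]
  have h2 := Within.push Reg.acc Token.neg (stk {
    work := w, source := s, weight := bits (k + 1), inputs := bits (N - j), val := bits j,
    acc := l, result := r })
  have h3 := within_forEach (k := Reg.weight) (k' := .row) (r := .acc) (by decide) (by decide)
    (by decide) (m := k + 1) (a := Token.bit)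
    (p := emit .tmp .acc [.inl .and, .inl .neg, .inl .atom, .inr .row,
        .inl .sep, .inl .bit, .inr .val, .inl .sep])
    (σ := stk {
      work := w, source := s, weight := bits (k + 1), inputs := bits (N - j), val := bits j,
      acc := .neg :: l, result := r })
    rfl rfl (f := fun i => Token.and :: (Formula.neg (.atom i (j + 1))).code)
    (T := 100 * (B + 1)) ?_
  rotate_left
  · intro i hi m
    simp only [update_stk, Regs.set]
    refine (within_emit_regs (by decide) _ (B := B) ?_ rfl).congr ?_ ?_
    · intro c hc
      simp only [List.mem_cons, reduceCtorEq, Sum.inr.injEq, or_false, List.not_mem_nil,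
        false_or] at hc
      rcases hc with rfl | rfl <;> simp [stk] <;> omega
    · simp [expand, Regs.set, stk, encNat, Formula.code, List.replicate_succ]
    · simp; omega
  simp only [update_stk, Regs.set, stk] at h2 h3
  have h4 := within_emit_regs (r := .acc) (by decide) {
      work := w, source := s, weight := bits (k + 1), inputs := bits (N - j), val := bits j,
      acc := (List.flatMap (fun i => Token.and :: (Formula.neg (.atom i (j + 1))).code)
        (List.range (k + 1))).reverse ++ .neg :: l, result := r }
    (is := (Formula.verum.code ++ [Token.or]).map .inl) (B := 0) (by simp) rfl
  refine (h2.seq (h3.seq h4)).congr ?_ ?_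
  · simp only [Regs.set, stk, Circuit.inputFormula, Formula.code_conj, Formula.code]
    simp [expand, List.flatMap_map, Formula.code]
  · have : (k + 1) * (100 * (B + 1) + 4) ≤ B * (100 * (B + 1) + 4) := by gcongr
    simp [Formula.verum, Formula.falsum, Formula.code, encNat]
    omega

/-- Read a list of node numbers and write the conjunction of the corresponding holes, with `pre` in
front of each one. -/
def writeConj (pre : List Token) : StackProg Reg Token :=
  seq (loop .source (isTok .next) <| seq (emit .tmp .acc (pre.map .inl)) <|
    seq (mv .source [.acc]) (moveNum .source .acc)) <|
  seq (mv .source []) (emit .tmp .acc (Formula.verum.code.map .inl))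

theorem within_emit_tokens (ρ : Regs) (ht : ρ.tmp = []) (l : List Token) :
    Within (emit .tmp .acc (l.map .inl)) ρ.stk { ρ with acc := l.reverse ++ ρ.acc }.stk
      (2 * l.length + 1) := by
  refine (within_emit_regs (by decide) ρ (is := l.map .inl) (B := 0) (by simp) ht).congr ?_ ?_
  · simp [expand, Regs.set, stk, List.flatMap_map]
  · simp; omega

theorem within_writeConj (ρ : Regs) (ht : ρ.tmp = []) {pre : List Token} (hpre : pre.length ≤ 2)
    (l : List ℕ) (s x : List Token) :
    Within (writeConj pre) (stk { ρ with source := encList encNat l ++ s, acc := x })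
      (stk { ρ with
        source := s
        acc := (l.flatMap (fun j => pre ++ Token.next :: encNat j) ++
          Formula.verum.code).reverse ++ x })
      (30 * (encList encNat l).length) := by
  have hloop : Within (loop .source (isTok .next) <| seq (emit .tmp .acc (pre.map .inl)) <|
      seq (mv .source [.acc]) (moveNum .source .acc))
      (stk { ρ with source := encList encNat l ++ s, acc := x })
      (stk { ρ with
        source := Token.last :: s
        acc := (l.flatMap (fun j => pre ++ Token.next :: encNat j)).reverse ++ x })
      (10 * (encList encNat l).length - 9) := by
    induction l generalizing x with
    | nil => exact (Within.loop_done (by simp [stk, encList, isTok])).mono (by simp [encList])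
    | cons j l ih =>
      have h1 := within_emit_tokens { ρ with
        source := encList encNat (j :: l) ++ s, acc := x } ht pre
      have h2 := Within.mv (k := Reg.source) (a := .next)
        (l := encNat j ++ (encList encNat l ++ s)) [.acc] (σ := stk { ρ with
          source := encList encNat (j :: l) ++ s, acc := pre.reverse ++ x }) (by simp [stk, encList])
      have h3 := within_moveNum (c := .source) (c' := .acc) (by decide) (σ := stk { ρ with
          source := encNat j ++ (encList encNat l ++ s)
          acc := .next :: (pre.reverse ++ x) }) rfl
      simp only [pushAll, update_stk, Regs.set, stk] at h1 h2 h3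
      refine (Within.loop_step (by simp [stk, encList, isTok]) (h1.seq (h2.seq h3)) (ih _)).congr
        ?_ ?_
      · simp
      · have : 1 ≤ (encList encNat l).length := by cases l <;> simp [encList]
        simp [encList, length_encNat]
        omega
  have h2 := Within.mv (k := Reg.source) (a := .last) (l := s) [] (σ := stk { ρ with
        source := Token.last :: s
        acc := (l.flatMap (fun j => pre ++ Token.next :: encNat j)).reverse ++ x }) rfl
  have h3 := within_emit_tokens { ρ with
        source := s
        acc := (l.flatMap (fun j => pre ++ Token.next :: encNat j)).reverse ++ x } ht
        Formula.verum.code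
  simp only [pushAll, update_stk, Regs.set] at h2
  refine (hloop.seq (h2.seq h3)).congr ?_ ?_
  · simp
  · have : 1 ≤ (encList encNat l).length := by cases l <;> simp [encList]
    simp [Formula.verum, Formula.falsum, Formula.code, encNat]
    omega

/-- Read a gate and write its formula. -/
def writeGate : StackProg Reg Token :=
  seq (mv .source []) <|
  seq (ite .source (isTok .neg)
    (seq (mv .source [.acc]) <| seq (push .acc .next) (moveNum .source .acc)) <|
    ite .source (isTok .and) (seq (mv .source []) (writeConj [.and]))
      (seq (mv .source []) <| seq (push .acc .neg) (writeConj [.and, .neg]))) <|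
  push .acc .or

theorem within_writeGate (ρ : Regs) (ht : ρ.tmp = []) (g : Gate) (s x : List Token) :
    Within writeGate (stk { ρ with source := Token.next :: (encGate g ++ s), acc := x })
      (stk { ρ with
        source := s
        acc := ((Circuit.gateFormula g).code ++ [Token.or]).reverse ++ x })
      (40 * (encGate g).length) := by
  have h1 := Within.mv (k := Reg.source) (a := .next) (l := encGate g ++ s) [] (σ := stk { ρ with
    source := Token.next :: (encGate g ++ s), acc := x }) rfl
  have h2 := Within.push Reg.acc Token.or (stk { ρ with
    source := s, acc := (Circuit.gateFormula g).code.reverse ++ x })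
  simp only [pushAll, update_stk, Regs.set, stk] at h1 h2
  have key : Within (ite .source (isTok .neg)
      (seq (mv .source [.acc]) <| seq (push .acc .next) (moveNum .source .acc)) <|
      ite .source (isTok .and) (seq (mv .source []) (writeConj [.and]))
        (seq (mv .source []) <| seq (push .acc .neg) (writeConj [.and, .neg])))
      (stk { ρ with source := encGate g ++ s, acc := x })
      (stk { ρ with source := s, acc := (Circuit.gateFormula g).code.reverse ++ x })
      (35 * (encGate g).length) := by
    cases g with
    | neg j =>
      have e1 := Within.mv (k := Reg.source) (a := .neg) (l := encNat j ++ s) [.acc]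
        (σ := stk { ρ with source := encGate (.neg j) ++ s, acc := x }) (by simp [encGate, stk])
      have e2 := Within.push Reg.acc Token.next
        (stk { ρ with source := encNat j ++ s, acc := .neg :: x })
      have e3 := within_moveNum (c := .source) (c' := .acc) (by decide)
        (σ := stk { ρ with source := encNat j ++ s, acc := .next :: .neg :: x }) rfl
      simp only [pushAll, update_stk, Regs.set, stk] at e1 e2 e3
      refine (Within.ite_pos (by simp [stk, encGate, isTok]) (e1.seq (e2.seq e3))).congr ?_ ?_
      · simp [Circuit.gateFormula, Formula.code]
      · simp [encGate, length_encNat]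
        omega
    | and l =>
      have e1 := Within.mv (k := Reg.source) (a := .and) (l := encList encNat l ++ s) []
        (σ := stk { ρ with source := encGate (.and l) ++ s, acc := x }) (by simp [encGate, stk])
      have e2 := within_writeConj ρ ht (pre := [.and]) (by simp) l s x
      simp only [pushAll, update_stk, Regs.set] at e1
      refine (Within.ite_neg (by simp [stk, encGate, isTok]) (Within.ite_pos
        (by simp [stk, encGate, isTok]) (e1.seq e2))).congr ?_ ?_
      · simp [Circuit.gateFormula, Formula.code_conj, Formula.code, List.flatMap_map]
      · simp [encGate]
        omega
    | or l =>
      have e1 := Within.mv (k := Reg.source) (a := .or) (l := encList encNat l ++ s) []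
        (σ := stk { ρ with source := encGate (.or l) ++ s, acc := x }) (by simp [encGate, stk])
      have e2 := Within.push Reg.acc Token.neg
        (stk { ρ with source := encList encNat l ++ s, acc := x })
      have e3 := within_writeConj ρ ht (pre := [.and, .neg]) (by simp) l s (.neg :: x)
      simp only [pushAll, update_stk, Regs.set, stk] at e1 e2
      refine (Within.ite_neg (by simp [stk, encGate, isTok]) (Within.ite_neg
        (by simp [stk, encGate, isTok]) (e1.seq (e2.seq e3)))).congr ?_ ?_
      · simp [Circuit.gateFormula, Formula.code_conj, Formula.code, List.flatMap_map]
      · simp [encGate]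
        omega
  refine (h1.seq (key.seq h2)).congr ?_ ?_
  · simp
  · have : 1 ≤ (encGate g).length := by cases g <;> simp [encGate]
    omega

/-- The formulas of the gates. -/
def writeGates : StackProg Reg Token :=
  seq (loop .source (isTok .next) writeGate) (mv .source [])

theorem within_writeGates (ρ : Regs) (ht : ρ.tmp = []) (gs : List Gate) (x : List Token) :
    Within writeGates (stk { ρ with source := encList encGate gs, acc := x })
      (stk { ρ with
        source := []
        acc := (tableCode (gs.map Circuit.gateFormula)).reverse ++ x })
      (50 * (encList encGate gs).length) := by
  have hloop : Within (loop .source (isTok .next) writeGate)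
      (stk { ρ with source := encList encGate gs, acc := x })
      (stk { ρ with
        source := [Token.last]
        acc := (tableCode (gs.map Circuit.gateFormula)).reverse ++ x })
      (49 * (encList encGate gs).length) := by
    induction gs generalizing x with
    | nil => exact (Within.loop_done (by simp [stk, encList, isTok])).mono (by simp [encList])
    | cons g gs ih =>
      refine (Within.loop_step (by simp [stk, isTok])
        (within_writeGate ρ ht g (encList encGate gs) x) (ih _)).congr ?_ ?_
      · simp [tableCode]
      · simp [encList]
        omega
  have h2 := Within.mv (k := Reg.source) (a := .last) (l := []) [] (σ := stk { ρ with
        source := [Token.last]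
        acc := (tableCode (gs.map Circuit.gateFormula)).reverse ++ x }) rfl
  simp only [pushAll, update_stk, Regs.set] at h2
  refine (hloop.seq h2).mono ?_
  have : 1 ≤ (encList encGate gs).length := by cases gs <;> simp [encList]
  omega

/-! ### Filling the holes of a formula -/

namespace Formula

theorem or_notMem_code (F : Formula) : Token.or ∉ F.code := by
  induction F with
  | hole j => simp [code, encNat]
  | atom V v => simp [code, encNat]
  | neg F ih => simp [code, ih]
  | and F G ihF ihG => simp [code, ihF, ihG]

theorem one_le_length_code (F : Formula) : 1 ≤ F.code.length := by
  cases F <;> simp [code]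

theorem length_code_subst_le {f : ℕ → Formula} {L n d : ℕ} {P : ℕ → Prop} {F : Formula}
    (hF : F.Bounded n d P) (hf : ∀ j, P j → (f j).code.length ≤ L) :
    (F.subst f).code.length ≤ F.code.length * (L + 1) := by
  induction F with
  | hole j =>
    have := hf j hF
    simp only [subst, code, List.length_cons]
    nlinarith
  | atom V v => simp only [subst]; nlinarith
  | neg F ih =>
    have := ih hF
    simp only [subst, code, List.length_cons]
    nlinarith
  | and F G ihF ihG =>
    have := ihF hF.1
    have := ihG hF.2
    simp only [subst, code, List.length_cons, List.length_append]
    nlinarith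

end Formula

theorem length_code_le_tableCode {tab : List Formula} {j : ℕ} (hj : j < tab.length) :
    (tab.getD j .verum).code.length ≤ (tableCode tab).length := by
  have hmem : tab.getD j .verum ∈ tab := by
    simp [List.getD, hj]
  rw [tableCode, List.length_flatMap]
  refine le_trans ?_ (List.le_sum_of_mem (List.mem_map_of_mem hmem))
  simp

/-- Test for an entry other than the end of a formula in a table. -/
def notOr : Option Token → Bool := fun o => o.isSome && decide (o ≠ some .or)

/-- Write the entry of the table whose number is on the stack `work`. -/
def lookup : StackProg Reg Token :=
  seq (loop .work (isTok .bit) <| seq (mv .work []) <|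
    seq (moveWhile .table notOr .tmp) (mv .table [.tmp])) <|
  seq (mv .work []) <| seq (copyWhile .table notOr .tmp .acc) (moveAll .tmp .table)

theorem notOr_of_mem_code {F : Formula} {a : Token} (ha : a ∈ F.code) : notOr (some a) = true := by
  have : a ≠ .or := fun h => F.or_notMem_code (h ▸ ha)
  simp [notOr, this]

theorem within_lookup (ρ : Regs) (ht : ρ.tmp = []) {tab : List Formula} {j : ℕ}
    (hj : j < tab.length) (w x : List Token) :
    Within lookup (stk { ρ with work := encNat j ++ w, acc := x, table := tableCode tab })
      (stk { ρ with
        work := w, acc := (tab.getD j .verum).code.reverse ++ x, table := tableCode tab })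
      (6 * (tableCode tab).length + 4) := by
  -- each bit of the number skips one formula of the table
  have skip : ∀ (l tab : List Formula) (t : List Token),
      Within (loop .work (isTok .bit) <| seq (mv .work []) <|
          seq (moveWhile .table notOr .tmp) (mv .table [.tmp]))
        (stk { ρ with
          work := encNat l.length ++ w, acc := x, tmp := t, table := tableCode (l ++ tab) })
        (stk { ρ with
          work := Token.sep :: w, acc := x, tmp := (tableCode l).reverse ++ t,
          table := tableCode tab })
        (4 * (tableCode l).length + 1) := by
    intro l tab
    induction l with
    | nil => exact fun t => Within.loop_done (by simp [stk, encNat, isTok])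
    | cons F l ih =>
      intro t
      have e1 := Within.mv (k := Reg.work) (a := .bit) (l := encNat l.length ++ w) []
        (σ := stk { ρ with
          work := encNat (F :: l).length ++ w, acc := x, tmp := t
          table := tableCode (F :: l ++ tab) }) (by simp [stk, encNat, List.replicate_succ])
      have e2 := within_moveWhile (k := Reg.table) (k' := .tmp) (by decide) (S := notOr)
        (l := F.code) (m := .or :: tableCode (l ++ tab)) (σ := stk { ρ with
          work := encNat l.length ++ w, acc := x, tmp := t
          table := tableCode (F :: l ++ tab) }) (by simp [stk, tableCode])
        (fun a ha => notOr_of_mem_code ha) (by simp [notOr])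
      have e3 := Within.mv (k := Reg.table) (a := .or) (l := tableCode (l ++ tab)) [.tmp]
        (σ := stk { ρ with
          work := encNat l.length ++ w, acc := x, tmp := F.code.reverse ++ t
          table := .or :: tableCode (l ++ tab) }) rfl
      simp only [pushAll, update_stk, Regs.set, stk] at e1 e2 e3
      refine (Within.loop_step (by simp [stk, encNat, isTok, List.replicate_succ])
        (e1.seq (e2.seq e3)) (ih _)).congr ?_ ?_
      · simp [tableCode]
      · simp [tableCode]
        omega
  set F := tab.getD j .verum with hF
  have htab : tab = tab.take j ++ F :: tab.drop (j + 1) := by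
    have : F = tab[j] := by simp [hF, List.getD, hj]
    rw [this, List.cons_getElem_drop_succ, List.take_append_drop]
  have h1 := skip (tab.take j) (F :: tab.drop (j + 1)) ρ.tmp
  rw [← htab, List.length_take, min_eq_left hj.le] at h1
  have h2 := Within.mv (k := Reg.work) (a := .sep) (l := w) [] (σ := stk { ρ with
    work := Token.sep :: w, acc := x, tmp := (tableCode (tab.take j)).reverse ++ ρ.tmp
    table := tableCode (F :: tab.drop (j + 1)) }) rfl
  have h3 := within_copyWhile (k := Reg.table) (tmp := .tmp) (k' := .acc) (by decide) (by decide)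
    (by decide) (S := notOr) (l := F.code) (m := .or :: tableCode (tab.drop (j + 1)))
    (σ := stk { ρ with
      work := w, acc := x, tmp := (tableCode (tab.take j)).reverse ++ ρ.tmp
      table := tableCode (F :: tab.drop (j + 1)) }) (by simp [stk, tableCode])
    (fun a ha => notOr_of_mem_code ha) (by simp [notOr])
  have h4 := within_moveAll (k := Reg.tmp) (k' := .table) (by decide) (stk { ρ with
    work := w, acc := F.code.reverse ++ x
    tmp := F.code.reverse ++ ((tableCode (tab.take j)).reverse ++ ρ.tmp)
    table := .or :: tableCode (tab.drop (j + 1)) })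
  simp only [pushAll, update_stk, Regs.set, stk] at h2 h3 h4
  have htc : tableCode tab = tableCode (tab.take j) ++ (F.code ++ .or ::
      tableCode (tab.drop (j + 1))) := by
    conv_lhs => rw [htab]
    simp [tableCode]
  refine (h1.seq (h2.seq (h3.seq h4))).congr ?_ ?_
  · simp [htc, ht]
  · rw [htc]
    simp [ht]
    omega

/-- Replace all holes of a formula by entries of the table. -/
def fillHoles : StackProg Reg Token :=
  seq (loop .work Option.isSome <|
    ite .work (isTok .next) (seq (mv .work []) lookup) (mv .work [.acc])) (moveAll .acc .work)

/-- Effect of the loop of `fillHoles` on a text without holes at the beginning of `work`. -/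
theorem within_fillLoop_tokens {ρ : Regs} {l : List Token} (hl : Token.next ∉ l) {w x : List Token}
    {σ : Reg → List Token} {T : ℕ}
    (h : Within (loop .work Option.isSome <|
      ite .work (isTok .next) (seq (mv .work []) lookup) (mv .work [.acc]))
      (stk { ρ with work := w, acc := l.reverse ++ x }) σ T) :
    Within (loop .work Option.isSome <|
      ite .work (isTok .next) (seq (mv .work []) lookup) (mv .work [.acc]))
      (stk { ρ with work := l ++ w, acc := x }) σ (T + 3 * l.length) := by
  induction l generalizing x with
  | nil => exact h
  | cons a l ih =>
    have ha : a ≠ Token.next := fun e => hl (by simp [e])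
    have h1 := ih (fun e => hl (by simp [e])) (x := a :: x) (by simpa using h)
    have e1 := Within.mv (k := Reg.work) (a := a) (l := l ++ w) [.acc] (σ := stk { ρ with
      work := a :: l ++ w, acc := x }) rfl
    simp only [pushAll, update_stk, Regs.set, stk] at e1
    refine (Within.loop_step rfl (Within.ite_neg (by simp [stk, isTok, ha]) e1) h1).mono ?_
    simp
    omega

/-- Effect of the loop of `fillHoles` on a formula at the beginning of `work`. -/
theorem within_fillLoop {ρ : Regs} (ht : ρ.tmp = []) {tab : List Formula}
    (htab : ρ.table = tableCode tab) {n d : ℕ} {F : Formula}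
    (hF : F.Bounded n d fun j => j < tab.length) {w x : List Token} {σ : Reg → List Token} {T : ℕ}
    (h : Within (loop .work Option.isSome <|
      ite .work (isTok .next) (seq (mv .work []) lookup) (mv .work [.acc]))
      (stk { ρ with
        work := w, acc := (F.subst fun j => tab.getD j .verum).code.reverse ++ x }) σ T) :
    Within (loop .work Option.isSome <|
      ite .work (isTok .next) (seq (mv .work []) lookup) (mv .work [.acc]))
      (stk { ρ with work := F.code ++ w, acc := x }) σ
      (T + F.code.length * (8 * ((tableCode tab).length + 1))) := by
  induction F generalizing w x T with
  | hole j =>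
    have e1 := Within.mv (k := Reg.work) (a := .next) (l := encNat j ++ w) [] (σ := stk { ρ with
      work := (Formula.hole j).code ++ w, acc := x }) rfl
    have e2 := within_lookup ρ ht (tab := tab) (j := j) hF w x
    rw [← htab] at e2
    simp only [pushAll, update_stk, Regs.set] at e1
    refine (Within.loop_step rfl (Within.ite_pos (by simp [stk, Formula.code, isTok])
      (e1.seq e2)) h).mono ?_
    rw [htab]
    simp [Formula.code, length_encNat]
    nlinarith
  | atom V v =>
    refine (within_fillLoop_tokens (l := (Formula.atom V v).code)
      (by simp [Formula.code, encNat]) h).mono ?_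
    nlinarith
  | neg F ih =>
    have h1 := within_fillLoop_tokens (ρ := ρ) (l := [Token.neg]) (by simp) (x := x)
      (ih hF (w := w) (x := Token.neg :: x) (by simpa [Formula.subst, Formula.code] using h))
    refine h1.mono ?_
    simp [Formula.code]
    nlinarith
  | and F G ihF ihG =>
    have h1 := within_fillLoop_tokens (ρ := ρ) (l := [Token.and]) (by simp) (x := x)
      (ihF hF.1 (w := G.code ++ w) (x := Token.and :: x) (ihG hF.2
        (by simpa [Formula.subst, Formula.code] using h)))
    simp only [Formula.code]
    rw [List.cons_append, List.append_assoc]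
    refine h1.mono ?_
    simp
    nlinarith

theorem within_fillHoles {ρ : Regs} (ht : ρ.tmp = []) (hacc : ρ.acc = []) {tab : List Formula}
    (htab : ρ.table = tableCode tab) {n d : ℕ} {F : Formula}
    (hF : F.Bounded n d fun j => j < tab.length) :
    Within fillHoles (stk { ρ with work := F.code })
      (stk { ρ with work := (F.subst fun j => tab.getD j .verum).code })
      (12 * (F.code.length * ((tableCode tab).length + 1))) := by
  set G := F.subst fun j => tab.getD j .verum with hG
  have h1 := within_fillLoop (ρ := ρ) (w := []) (x := []) ht htab hF
    (Within.loop_done (by simp [stk]))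
  have h2 := within_moveAll (k := Reg.acc) (k' := .work) (by decide) (stk { ρ with
    work := [], acc := G.code.reverse ++ [] })
  simp only [update_stk, Regs.set, stk] at h2
  rw [List.append_nil, ← hG] at h1
  have e : ({ ρ with work := F.code, acc := [] } : Regs) = { ρ with work := F.code } := by
    rw [← hacc]
  rw [e] at h1
  refine (h1.seq h2).congr ?_ ?_
  · simp [hacc]
  · have := Formula.length_code_subst_le hF fun j hj => length_code_le_tableCode hj
    have := F.one_le_length_code
    simp only [List.append_nil, List.length_reverse]
    rw [← hG] at *
    nlinarith

end CausalSat

namespace CausalSat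

open Function StackProg

open Regs

/-! ### The program of the reduction -/

/-- Read the input and write the constraints on the variables and the table in reverse. -/
def writeTable : StackProg Reg Token :=
  seq parse <| seq writeHeader <| seq writePairs <| seq (mv .inputs []) <|
    seq writeInputs writeGates

/-- Fill the holes `t` times. The stack `tmp` is empty, so that clearing it changes nothing. -/
def fillRounds : ℕ → StackProg Reg Token
  | 0 => clear .tmp
  | t + 1 => seq (fillRounds t) fillHoles

/-- Write the constraint that the circuit accepts, clean up and deliver the output. -/
def finish : StackProg Reg Token :=
  seq (emit .tmp .result ([Token.next, Token.neg].map .inl)) <| seq (moveAll .work .result) <|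
  seq (emit .tmp .result ((Formula.falsum.code ++ [Token.last]).map .inl)) <|
  seq (clear .weight) <| seq (clear .inputs) <| seq (clear .table) (moveAll .result .work)

/-- The program that computes the reduction for circuits of depth at most `h`. -/
def reductionProg (h : ℕ) : StackProg Reg Token :=
  seq writeTable <| seq (moveAll .acc .table) <| seq (fillRounds (h + 1)) finish

/-- The text of all constraints but the last one. -/
def constraintsText (k N : ℕ) : List Token :=
  encNat (k + 1) ++ encNat (N + 1) ++ Token.next :: ((Formula.neg (.atom 0 0)).code ++
    Formula.falsum.code) ++ (List.range (k + 1)).flatMap fun i => (List.range i).flatMap fun j =>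
      (List.range (N + 1)).flatMap fun v =>
        Token.next :: ((Formula.and (.atom i v) (.atom j v)).code ++ Formula.falsum.code)

/-- A bound on the running time of `writeTable`. -/
def tableTime (B : ℕ) : ℕ :=
  30 * B + (100 * (B + 1) + ((B * (B * (B * (100 * (B + 1) + 4) + 2 + 4) + 2 + 4) + 2) + (1 +
    ((B * (1 + (B * (100 * (B + 1) + 4) + 2 + 100) + 4) + 2) + 50 * B))))

theorem within_writeTable {C : Circuit} {k B : ℕ}
    (hB : (encNat k ++ encCircuit C).length < B) :
    Within writeTable (stk { work := (encNat k ++ encCircuit C).reverse })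
      (stk {
        work := Token.next :: encNat C.out, weight := bits (k + 1), inputs := bits C.inputs,
        acc := (tableCode (C.table k)).reverse
        result := (constraintsText k C.inputs).reverse }) (tableTime B) := by
  have hk : k + 1 ≤ B := by simp [length_encNat] at hB; omega
  have hN : C.inputs + 1 ≤ B := by simp [length_encNat, encCircuit] at hB; omega
  have hg : (encList encGate C.gates).length ≤ B := by simp [encCircuit] at hB; omega
  have h1 := within_parse k C.inputs C.out (encList encGate C.gates) hB
  have h2 := within_writeHeader hk hN (w := Token.next :: encNat C.out)
    (s := encList encGate C.gates)
  have h3 := within_writePairs hk hN (w := Token.next :: encNat C.out)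
    (s := encList encGate C.gates) (r := (encNat (k + 1) ++ encNat (C.inputs + 1) ++
      Token.next :: ((Formula.neg (.atom 0 0)).code ++ Formula.falsum.code)).reverse)
  rw [← List.reverse_append] at h3
  have h4 := Within.mv (k := Reg.inputs) (a := .bit) (l := bits C.inputs) [] (σ := stk {
    work := Token.next :: encNat C.out, source := encList encGate C.gates
    weight := bits (k + 1), inputs := bits (C.inputs + 1)
    result := (constraintsText k C.inputs).reverse }) rfl
  have h5 := within_writeInputs hk (Nat.le_of_succ_le hN) (w := Token.next :: encNat C.out)
    (s := encList encGate C.gates) (r := (constraintsText k C.inputs).reverse)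
  have h6 := within_writeGates {
    work := Token.next :: encNat C.out
    weight := bits (k + 1), inputs := bits C.inputs
    result := (constraintsText k C.inputs).reverse } rfl C.gates
      (tableCode ((List.range C.inputs).map (Circuit.inputFormula k))).reverse
  simp only [pushAll, update_stk, Regs.set] at h4
  refine (h1.seq <| h2.seq <| h3.seq <| h4.seq <| h5.seq h6).congr ?_ ?_
  · simp [Circuit.table, tableCode]
  · unfold tableTime
    gcongr

/-- Every round of unrolling multiplies the length at most by
one more than that of the table. -/
theorem length_unroll_le {C : Circuit} (hC : C.WellFormed) (k : ℕ) {h : ℕ} (hd : C.depth ≤ h)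
    {t : ℕ} (ht : t ≤ h + 1) : (C.unroll k t).code.length ≤
      (C.out + 2) * ((tableCode (C.table k)).length + 1) ^ t := by
  induction t with
  | zero => simp [Circuit.unroll, Formula.code, length_encNat]
  | succ t ih =>
    refine (Formula.length_code_subst_le (Circuit.bounded_unroll hC k hd (t := t) (by omega))
      (f := C.nodeFormula k) (L := (tableCode (C.table k)).length)
      fun j hj => length_code_le_tableCode (by rw [Circuit.length_table]; exact hj.1)).trans ?_
    rw [pow_succ, ← mul_assoc]
    exact Nat.mul_le_mul_right _ (ih (by omega))

theorem within_fillRounds {C : Circuit} (hC : C.WellFormed) (k : ℕ) {h : ℕ} (hd : C.depth ≤ h)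
    {ρ : Regs} (htmp : ρ.tmp = []) (hacc : ρ.acc = []) (htab : ρ.table = tableCode (C.table k))
    {t : ℕ} (ht : t ≤ h + 1) :
    Within (fillRounds t) (stk { ρ with work := Token.next :: encNat C.out })
      (stk { ρ with work := (C.unroll k t).code })
      (12 * ((t + 1) * ((C.out + 2) * ((tableCode (C.table k)).length + 1) ^ (t + 1)))) := by
  set D := (tableCode (C.table k)).length + 1 with hD
  induction t with
  | zero =>
    refine (within_clear Reg.tmp _).congr ?_ ?_
    · rw [update_stk]
      simp [Regs.set, Circuit.unroll, Formula.code, htmp]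
    · simp only [stk, htmp]
      simp
      nlinarith
  | succ t ih =>
    have h1 := within_fillHoles (ρ := ρ) htmp hacc htab (F := C.unroll k t)
      ((Circuit.bounded_unroll hC k hd (t := t) (by omega)).mono fun j hj => by
        rw [Circuit.length_table]; exact hj.1)
    refine ((ih (by omega)).seq h1).mono ?_
    rw [← hD]
    have h2 := length_unroll_le hC k hd (t := t) (by omega)
    rw [← hD] at h2
    have h3 : (C.unroll k t).code.length * D ≤ (C.out + 2) * D ^ (t + 1) := by
      rw [pow_succ, ← mul_assoc]
      exact Nat.mul_le_mul_right _ h2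
    have h4 : (C.out + 2) * D ^ (t + 1) ≤ (C.out + 2) * D ^ (t + 1 + 1) :=
      Nat.mul_le_mul_left _ (Nat.pow_le_pow_right (by omega) (by omega))
    nlinarith

theorem within_finish {k N : ℕ} {F : List Token} {T R : List Token} :
    Within finish (stk {
        work := F, weight := bits k, inputs := bits N, table := T, result := R.reverse })
      (stk { work := R ++ (Token.next :: Token.neg :: F ++
        (Formula.falsum.code ++ [Token.last])) })
      (2 * k + 2 * N + 2 * T.length + 2 * R.length + 4 * F.length + 100) := by
  have h1 := within_emit_regs (r := .result) (by decide) {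
    work := F, weight := bits k, inputs := bits N, table := T, result := R.reverse }
    (is := [Token.next, Token.neg].map .inl) (B := 0) (by simp) rfl
  have h2 := within_moveAll (k := Reg.work) (k' := .result) (by decide) (stk {
    work := F, weight := bits k, inputs := bits N, table := T
    result := Token.neg :: Token.next :: R.reverse })
  have h3 := within_emit_regs (r := .result) (by decide) {
    weight := bits k, inputs := bits N, table := T
    result := F.reverse ++ Token.neg :: Token.next :: R.reverse }
    (is := (Formula.falsum.code ++ [Token.last]).map .inl) (B := 0) (by simp) rfl
  set R' := (Formula.falsum.code ++ [Token.last]).reverse ++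
    (F.reverse ++ Token.neg :: Token.next :: R.reverse) with hR'
  have h4 := within_clear Reg.weight (stk {
    weight := bits k, inputs := bits N, table := T, result := R' })
  have h5 := within_clear Reg.inputs (stk { inputs := bits N, table := T, result := R' })
  have h6 := within_clear Reg.table (stk { table := T, result := R' })
  have h7 := within_moveAll (k := Reg.result) (k' := .work) (by decide) (stk { result := R' })
  have e : ∀ σ : Reg → List Token, expand σ ((Formula.falsum.code ++ [Token.last]).map .inl) =
      Formula.falsum.code ++ [Token.last] := fun σ => by simp [expand, List.flatMap_map]
  simp only [update_stk, Regs.set, stk, e, ← hR'] at h1 h2 h3 h4 h5 h6 h7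
  refine (h1.seq <| h2.seq <| h3.seq <| h4.seq <| h5.seq <| h6.seq h7).congr ?_ ?_
  · simp [hR']
  · simp [hR', Formula.falsum, Formula.code, encNat]
    omega

/-- The text of the instance is the concatenation of what the program writes. -/
theorem encSatInstance_eq_text {C : Circuit} (hC : C.WellFormed) {k h : ℕ} (hd : C.depth ≤ h) :
    encSatInstance (satOfCircuit C k h) = constraintsText k C.inputs ++
      (Token.next :: Token.neg :: (C.unroll k (h + 1)).code ++
        (Formula.falsum.code ++ [Token.last])) := by
  rw [encSatInstance_satOfCircuit hC hd]
  simp [forbidden, constraintsText, List.flatMap_assoc, List.flatMap_map, Formula.code]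

/-! ### Polynomial bounds -/

/-- Functions bounded by a polynomial. -/
def PolyBounded (f : ℕ → ℕ) : Prop := ∃ C e : ℕ, ∀ n, f n ≤ C * (n + 1) ^ e

theorem PolyBounded.const (c : ℕ) : PolyBounded fun _ => c := ⟨c, 0, fun n => by simp⟩

theorem PolyBounded.id : PolyBounded fun n => n := ⟨1, 1, fun n => by simp⟩

theorem PolyBounded.add {f g : ℕ → ℕ} (hf : PolyBounded f) (hg : PolyBounded g) :
    PolyBounded fun n => f n + g n := by
  obtain ⟨C, e, hf⟩ := hf
  obtain ⟨D, d, hg⟩ := hg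
  refine ⟨C + D, e + d, fun n => ?_⟩
  rw [add_mul]
  refine add_le_add ((hf n).trans ?_) ((hg n).trans ?_)
  · exact Nat.mul_le_mul_left _ (Nat.pow_le_pow_right (by omega) (by omega))
  · exact Nat.mul_le_mul_left _ (Nat.pow_le_pow_right (by omega) (by omega))

theorem PolyBounded.mul {f g : ℕ → ℕ} (hf : PolyBounded f) (hg : PolyBounded g) :
    PolyBounded fun n => f n * g n := by
  obtain ⟨C, e, hf⟩ := hf
  obtain ⟨D, d, hg⟩ := hg
  refine ⟨C * D, e + d, fun n => (Nat.mul_le_mul (hf n) (hg n)).trans (le_of_eq ?_)⟩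
  rw [pow_add]
  ring

theorem PolyBounded.pow {f : ℕ → ℕ} (hf : PolyBounded f) (e : ℕ) :
    PolyBounded fun n => f n ^ e := by
  induction e with
  | zero => simpa using PolyBounded.const 1
  | succ e ih => simpa [pow_succ] using ih.mul hf

/-- A bound on the lengths of the table and of the text of the constraints, which comes from the time
that it takes to write them. -/
def textBound (n : ℕ) : ℕ := n + writeTable.width * tableTime (n + 1)

/-- A bound on the running time of the program. -/
def reductionTime (h n : ℕ) : ℕ :=
  tableTime (n + 1) + ((2 * textBound n + 1) +
    (12 * ((h + 2) * ((n + 2) * (textBound n + 1) ^ (h + 2))) +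
      (4 * n + 4 * textBound n + 4 * ((n + 2) * (textBound n + 1) ^ (h + 1)) + 102)))

theorem polyBounded_tableTime : PolyBounded fun n => tableTime (n + 1) := by
  unfold tableTime
  repeat' first
    | exact PolyBounded.const _
    | exact PolyBounded.id
    | apply PolyBounded.add
    | apply PolyBounded.mul

theorem polyBounded_reductionTime (h : ℕ) : PolyBounded (reductionTime h) := by
  have h1 : PolyBounded textBound :=
    PolyBounded.id.add ((PolyBounded.const _).mul polyBounded_tableTime)
  have h2 : PolyBounded fun n => n + 2 := PolyBounded.id.add (PolyBounded.const 2)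
  have h3 : ∀ e, PolyBounded fun n => (n + 2) * (textBound n + 1) ^ e := fun e =>
    h2.mul ((h1.add (PolyBounded.const 1)).pow e)
  exact polyBounded_tableTime.add ((((PolyBounded.const 2).mul h1).add (PolyBounded.const 1)).add
    (((PolyBounded.const 12).mul ((PolyBounded.const (h + 2)).mul (h3 (h + 2)))).add
      (((((PolyBounded.const 4).mul PolyBounded.id).add ((PolyBounded.const 4).mul h1)).add
        ((PolyBounded.const 4).mul (h3 (h + 1)))).add (PolyBounded.const 102))))

/-- The program computes the reduction in polynomial time. -/
theorem within_reductionProg {C : Circuit} (hC : C.WellFormed) {k h : ℕ} (hd : C.depth ≤ h) :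
    Within (reductionProg h) (stk { work := (encNat k ++ encCircuit C).reverse })
      (stk { work := encSatInstance (satOfCircuit C k h) })
      (reductionTime h (encNat k ++ encCircuit C).length) := by
  set n := (encNat k ++ encCircuit C).length with hn
  have hk : k + C.inputs + C.out + 3 ≤ n := by
    simp [hn, encCircuit, length_encNat]; omega
  have h1 := within_writeTable (C := C) (k := k) (B := n + 1) (by omega)
  have hacc := h1.length_le .acc
  have hres := h1.length_le .result
  simp only [stk, List.length_reverse, List.length_nil, zero_add] at hacc hres
  set D := (tableCode (C.table k)).length with hD
  have hacc' : D ≤ textBound n := hacc.trans (Nat.le_add_left _ _)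
  have hres' : (constraintsText k C.inputs).length ≤ textBound n :=
    hres.trans (Nat.le_add_left _ _)
  have h2 := within_moveAll (k := Reg.acc) (k' := .table) (by decide) (stk {
        work := Token.next :: encNat C.out, weight := bits (k + 1), inputs := bits C.inputs,
        acc := (tableCode (C.table k)).reverse
        result := (constraintsText k C.inputs).reverse })
  simp only [update_stk, Regs.set, stk, List.reverse_reverse, List.append_nil,
    List.length_reverse] at h2
  have h3 := within_fillRounds hC k hd (ρ := {
        weight := bits (k + 1), inputs := bits C.inputs, table := tableCode (C.table k)
        result := (constraintsText k C.inputs).reverse }) rfl rfl rfl (le_refl (h + 1))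
  have h4 := within_finish (k := k + 1) (N := C.inputs) (F := (C.unroll k (h + 1)).code)
    (T := tableCode (C.table k)) (R := constraintsText k C.inputs)
  have hF := length_unroll_le hC k hd (le_refl (h + 1))
  rw [← hD] at h2 h3 h4 hF
  refine (h1.seq <| h2.seq <| h3.seq h4).congr ?_ ?_
  · rw [encSatInstance_eq_text hC hd]
  · have e1 : 12 * ((h + 1 + 1) * ((C.out + 2) * (D + 1) ^ (h + 1 + 1))) ≤
        12 * ((h + 2) * ((n + 2) * (textBound n + 1) ^ (h + 2))) := by
      gcongr
      omega
    have e2 : (C.out + 2) * (D + 1) ^ (h + 1) ≤ (n + 2) * (textBound n + 1) ^ (h + 1) := by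
      gcongr
      omega
    unfold reductionTime
    omega

/-! ### Hardness -/

/-- Every parameter that is at most the number of variables makes SAT(prob, base)
W[1]-hard. -/
theorem isW1Hard_satProbBase {κ : SatInstance → ℕ} (hκ : ∀ I, κ I ≤ I.n) :
    IsW1Hard (satProbBase κ) := by
  rintro P ⟨h, r, hr, hyes, g, hg, hparam⟩
  obtain ⟨A, e, hT⟩ := polyBounded_reductionTime h
  let : Inhabited (satProbBase κ).Sym := ⟨Token.bit⟩
  refine ⟨_, hr.comp_stackProg (R := satProbBase κ) (fun I => satOfCircuit I.1.1 I.2 h)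
    (Equiv.refl Token) (reductionProg h) .work .work A e ?_, fun a => ?_, fun k => g k + 1,
    Computable.succ.comp hg, fun a => ?_⟩
  · rintro ⟨⟨C, hC, -, hd⟩, k⟩
    obtain ⟨t, ht, hrun⟩ := within_reductionProg hC (k := k) hd
    refine ⟨t, ht.trans (hT _), ?_⟩
    have e0 : (fun _ : Reg => ([] : List Token)) = stk {} := by
      funext c; cases c <;> rfl
    have e1 : ∀ l, update (fun _ : Reg => ([] : List Token)) .work l = stk { work := l } :=
      fun l => by rw [e0, update_stk]; rfl
    have e2 : Runs (reductionProg h)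
        (update (fun _ => []) .work ((encNat k ++ encCircuit C).map (Equiv.refl Token)).reverse)
        (update (fun _ => []) .work (encSatInstance (satOfCircuit C k h))) t := by
      rw [e1, e1, show (encNat k ++ encCircuit C).map (Equiv.refl Token) = encNat k ++ encCircuit C
        from List.map_id _]
      exact hrun
    exact e2
  · have hI := (r a).1.2
    exact (hyes a).trans (satisfiable_satOfCircuit_iff hI.1 hI.2.2).symm
  · exact (hκ _).trans (Nat.succ_le_succ (hparam a))

end CausalSat

/-- SAT(prob, base) is W[1]-hard when parameterized by the number of variables, and when
parameterized by the primal treewidth. -/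
theorem theorem4p3 :
    CausalSat.IsW1Hard (CausalSat.satProbBase fun I => I.n) ∧
    CausalSat.IsW1Hard (CausalSat.satProbBase fun I => CausalSat.treewidth I.primalGraph) :=
  ⟨CausalSat.isW1Hard_satProbBase fun _ => le_rfl,
    CausalSat.isW1Hard_satProbBase fun I => CausalSat.treewidth_le I.primalGraph⟩
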